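/- **Theorem (Duality).** Let $d \ge 1$. For $u \in L^1(\mathbb{R}^d)$ let $$\|Du\|(\mathbb{R}^d) = \sup\Big\{ \int_{\mathbb{R}^d} u \operatorname{div} v : v \in C^1_c(\mathbb{R}^d;\mathbb{R}^d),\ \|v\|_\infty \le 1 \Big\},$$ where $\|v\|_\infty = \sup_x |v(x)|$ for the Euclidean norm $|\cdot|$. Let $BV([0,1]^d)$ be the space of all $u \in L^1(\mathbb{R}^d)$ such that $u = 0$ almost everywhere on $\mathbb{R}^d \setminus [0,1]^d$ and $\|Du\|(\mathbb{R}^d) < \infty$, normed by $\|u\|_{BV} = \|Du\|(\mathbb{R}^d)$. Each $u \in BV([0,1]^d)$ has a distributional gradient $Du$, that is, a finite $\mathbb{R}^d$-valued Borel measure on $\mathbb{R}^d$ with $\int u \operatorname{div} v = -\int v \cdot dDu$ for all $v \in C^1_c(\mathbb{R}^d;\mathbb{R}^d)$. For every continuous $v : [0,1]^d \to \mathbb{R}^d$, the formula $$(\operatorname{div} v)(u) = -\int_{[0,1]^d} v \cdot dDu \qquad (u \in BV([0,1]^d))$$ defines an element $\operatorname{div} v$ of the dual $BV([0,1]^d)^*$.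 Let $$CH([0,1]^d) = \{ \operatorname{div} v : v \in C([0,1]^d;\mathbb{R}^d) \} \subset BV([0,1]^d)^*,$$ with the operator norm inherited from $BV([0,1]^d)^*$ (no closure is taken). Then the canonical map $$\Upsilon : BV([0,1]^d) \to CH([0,1]^d)^*, \qquad \Upsilon(u)(\omega) = \omega(u),$$ is an isometric isomorphism of Banach spaces: it is linear, bijective and norm-preserving, and $BV([0,1]^d)$ is complete. -/

import Mathlib

open MeasureTheory Set Filter Topology
open scoped ENNReal

noncomputable section

namespace BVDuality

/-- The closed unit cube `[0,1]^d` in Euclidean space. -/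
def cube (d : ℕ) : Set (EuclideanSpace ℝ (Fin d)) :=
  {x | ∀ i, x i ∈ Icc (0 : ℝ) 1}

/-- The divergence `∑ i, ∂ᵢ vᵢ` of a vector field. -/
def divergence {d : ℕ} (v : EuclideanSpace ℝ (Fin d) → EuclideanSpace ℝ (Fin d))
    (x : EuclideanSpace ℝ (Fin d)) : ℝ :=
  ∑ i, (fderiv ℝ v x (EuclideanSpace.single i 1)) i

/-- `v ∈ C¹_c(ℝ^d; ℝ^d)`. -/
def IsTestField {d : ℕ} (v : EuclideanSpace ℝ (Fin d) → EuclideanSpace ℝ (Fin d)) : Prop :=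
  ContDiff ℝ 1 v ∧ HasCompactSupport v

/-- The De Giorgi variation `‖Du‖(ℝ^d)`, an extended nonnegative number. -/
def deGiorgiVariation {d : ℕ} (u : EuclideanSpace ℝ (Fin d) → ℝ) : ℝ≥0∞ :=
  ⨆ (v : EuclideanSpace ℝ (Fin d) → EuclideanSpace ℝ (Fin d))
    (_ : IsTestField v ∧ ∀ x, ‖v x‖ ≤ 1), ENNReal.ofReal (∫ x, u x * divergence v x)

section Helpers

variable {d : ℕ}

lemma divergence_smul {v : EuclideanSpace ℝ (Fin d) → EuclideanSpace ℝ (Fin d)}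
    (hv : IsTestField v) (c : ℝ) (x : EuclideanSpace ℝ (Fin d)) :
    divergence (fun y => c • v y) x = c * divergence v x := by
  have hd : DifferentiableAt ℝ v x := (hv.1.differentiable one_ne_zero) x
  simp only [divergence]
  rw [fderiv_fun_const_smul hd]
  simp [Finset.mul_sum]

lemma IsTestField.smul {v : EuclideanSpace ℝ (Fin d) → EuclideanSpace ℝ (Fin d)}
    (hv : IsTestField v) (c : ℝ) : IsTestField (fun y => c • v y) :=
  ⟨hv.1.const_smul c, hv.2.comp_left (g := fun z => c • z) (smul_zero c)⟩

lemma isTestField_zero :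
    IsTestField (fun _ : EuclideanSpace ℝ (Fin d) => (0 : EuclideanSpace ℝ (Fin d))) :=
  ⟨contDiff_const, HasCompactSupport.zero⟩

lemma continuous_divergence {v : EuclideanSpace ℝ (Fin d) → EuclideanSpace ℝ (Fin d)}
    (hv : IsTestField v) : Continuous (divergence v) := by
  have h := hv.1.continuous_fderiv one_ne_zero
  unfold divergence
  fun_prop

lemma hasCompactSupport_divergence
    {v : EuclideanSpace ℝ (Fin d) → EuclideanSpace ℝ (Fin d)}
    (hv : IsTestField v) : HasCompactSupport (divergence v) := by
  have h : HasCompactSupport (fderiv ℝ v) := hv.2.fderiv ℝ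
  exact h.comp_left
    (g := fun L : EuclideanSpace ℝ (Fin d) →L[ℝ] EuclideanSpace ℝ (Fin d) =>
      ∑ i, (L (EuclideanSpace.single i 1)) i) (by simp)

lemma integrable_mul_divergence {u : EuclideanSpace ℝ (Fin d) → ℝ} (hu : Integrable u)
    {v : EuclideanSpace ℝ (Fin d) → EuclideanSpace ℝ (Fin d)} (hv : IsTestField v) :
    Integrable (fun x => u x * divergence v x) := by
  obtain ⟨C, hC⟩ := (continuous_divergence hv).bounded_above_of_compact_support
    (hasCompactSupport_divergence hv)
  exact hu.mul_bdd (c := C) (continuous_divergence hv).aestronglyMeasurable (Eventually.of_forall hC)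

lemma le_deGiorgiVariation (u : EuclideanSpace ℝ (Fin d) → ℝ)
    {v : EuclideanSpace ℝ (Fin d) → EuclideanSpace ℝ (Fin d)}
    (hv : IsTestField v) (hv1 : ∀ x, ‖v x‖ ≤ 1) :
    ENNReal.ofReal (∫ x, u x * divergence v x) ≤ deGiorgiVariation u :=
  le_iSup₂ (f := fun v (_ : IsTestField v ∧ ∀ x, ‖v x‖ ≤ 1) =>
    ENNReal.ofReal (∫ x, u x * divergence v x)) v ⟨hv, hv1⟩

lemma abs_le_deGiorgiVariation (u : EuclideanSpace ℝ (Fin d) → ℝ)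
    {v : EuclideanSpace ℝ (Fin d) → EuclideanSpace ℝ (Fin d)}
    (hv : IsTestField v) (hv1 : ∀ x, ‖v x‖ ≤ 1) :
    ENNReal.ofReal |∫ x, u x * divergence v x| ≤ deGiorgiVariation u := by
  rcases abs_choice (∫ x, u x * divergence v x) with h | h <;> rw [h]
  · exact le_deGiorgiVariation u hv hv1
  · have h1 : ∀ x, ‖(-1 : ℝ) • v x‖ ≤ 1 := fun x => by simpa using hv1 x
    have := le_deGiorgiVariation u (hv.smul (-1)) h1
    simp only [divergence_smul hv] at this
    have h2 : ∀ x, u x * (-1 * divergence v x) = -(u x * divergence v x) := fun x => by ring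
    simp only [h2] at this
    rwa [integral_neg (fun x => u x * divergence v x)] at this

lemma deGiorgiVariation_congr {u w : EuclideanSpace ℝ (Fin d) → ℝ} (h : u =ᵐ[volume] w) :
    deGiorgiVariation u = deGiorgiVariation w := by
  have h1 : ∀ v : EuclideanSpace ℝ (Fin d) → EuclideanSpace ℝ (Fin d),
      ∫ x, u x * divergence v x = ∫ x, w x * divergence v x := fun v => by
    refine integral_congr_ae ?_
    filter_upwards [h] with x hx
    rw [hx]
  simp only [deGiorgiVariation, h1]

lemma deGiorgiVariation_zero :
    deGiorgiVariation (fun _ : EuclideanSpace ℝ (Fin d) => (0 : ℝ)) = 0 := by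
  simp [deGiorgiVariation]

lemma deGiorgiVariation_add_le {u w : EuclideanSpace ℝ (Fin d) → ℝ}
    (hu : Integrable u) (hw : Integrable w) :
    deGiorgiVariation (fun x => u x + w x) ≤ deGiorgiVariation u + deGiorgiVariation w := by
  refine iSup₂_le fun v hv => ?_
  simp only [add_mul]
  rw [integral_add (integrable_mul_divergence hu hv.1) (integrable_mul_divergence hw hv.1)]
  exact ENNReal.ofReal_add_le.trans
    (add_le_add (le_deGiorgiVariation u hv.1 hv.2) (le_deGiorgiVariation w hv.1 hv.2))

lemma deGiorgiVariation_smul_le (c : ℝ) (u : EuclideanSpace ℝ (Fin d) → ℝ) :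
    deGiorgiVariation (fun x => c * u x) ≤ ENNReal.ofReal |c| * deGiorgiVariation u := by
  refine iSup₂_le fun v hv => ?_
  simp only [mul_assoc]
  rw [integral_const_mul]
  calc ENNReal.ofReal (c * ∫ x, u x * divergence v x)
      ≤ ENNReal.ofReal (|c| * |∫ x, u x * divergence v x|) :=
        ENNReal.ofReal_le_ofReal ((le_abs_self _).trans (abs_mul _ _).le)
    _ = ENNReal.ofReal |c| * ENNReal.ofReal |∫ x, u x * divergence v x| :=
        ENNReal.ofReal_mul (abs_nonneg c)
    _ ≤ _ := by gcongr; exact abs_le_deGiorgiVariation u hv.1 hv.2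

/-- A function of zero variation pairs to zero with every divergence. -/
lemma integral_mul_divergence_eq_zero {u : EuclideanSpace ℝ (Fin d) → ℝ}
    (h0 : deGiorgiVariation u = 0)
    {v : EuclideanSpace ℝ (Fin d) → EuclideanSpace ℝ (Fin d)} (hv : IsTestField v) :
    ∫ x, u x * divergence v x = 0 := by
  obtain ⟨C, hC⟩ := hv.1.continuous.bounded_above_of_compact_support hv.2
  have hC0 : 0 < |C| + 1 := by positivity
  have h1 : ∀ x, ‖(|C| + 1)⁻¹ • v x‖ ≤ 1 := fun x => by
    rw [norm_smul, norm_inv, Real.norm_of_nonneg hC0.le, inv_mul_le_one₀ hC0]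
    linarith [hC x, le_abs_self C]
  have := abs_le_deGiorgiVariation u (hv.smul (|C| + 1)⁻¹) h1
  simp only [divergence_smul hv, h0, nonpos_iff_eq_zero, ENNReal.ofReal_eq_zero] at this
  have h2 : ∫ x, u x * ((|C| + 1)⁻¹ * divergence v x) = 0 := by
    simpa using this
  have h3 : ∀ x, u x * ((|C| + 1)⁻¹ * divergence v x)
      = (|C| + 1)⁻¹ * (u x * divergence v x) := fun x => by ring
  simp only [h3] at h2
  rw [integral_const_mul] at h2
  exact (mul_eq_zero.1 h2).resolve_left (inv_ne_zero hC0.ne')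

lemma isCompact_cube : IsCompact (cube d) := by
  have : cube d = (EuclideanSpace.equiv (Fin d) ℝ) ⁻¹' (univ.pi fun _ => Icc (0 : ℝ) 1) := by
    ext x; simp [cube, Pi.le_def, forall_and]
  rw [this]
  exact (EuclideanSpace.equiv (Fin d) ℝ).toHomeomorph.isCompact_preimage.2
    (isCompact_univ_pi fun _ => isCompact_Icc)

lemma measurableSet_cube : MeasurableSet (cube d) := isCompact_cube.isClosed.measurableSet

/-- A compactly supported integrable function of zero variation vanishes almost everywhere. -/
lemma ae_eq_zero_of_deGiorgiVariation_eq_zero [NeZero d] {u : EuclideanSpace ℝ (Fin d) → ℝ}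
    (hu : Integrable u) (hc : ∀ᵐ x, x ∉ cube d → u x = 0) (h0 : deGiorgiVariation u = 0) :
    u =ᵐ[volume] 0 := by
  let φ : ℕ → ContDiffBump (0 : EuclideanSpace ℝ (Fin d)) := fun n =>
    ⟨(1 / ((n : ℝ) + 1)) / 2, 1 / ((n : ℝ) + 1), by positivity, half_lt_self (by positivity)⟩
  have hlim : Tendsto (fun n => (φ n).rOut) atTop (𝓝 0) := tendsto_one_div_add_atTop_nhds_zero_nat
  have hK : ∀ᶠ n in atTop, (φ n).rOut ≤ 2 * (φ n).rIn := Eventually.of_forall fun n => by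
    simp only [φ]; linarith
  have hae := ContDiffBump.ae_convolution_tendsto_right_of_locallyIntegrable
    (μ := (volume : Measure (EuclideanSpace ℝ (Fin d)))) hlim hK hu.locallyIntegrable
  have key : ∀ n x, (convolution ((φ n).normed volume) u (ContinuousLinearMap.lsmul ℝ ℝ)
      volume) x = 0 := by
    intro n
    set ψ : EuclideanSpace ℝ (Fin d) → ℝ := (φ n).normed volume with hψ
    have hψ1 : ContDiff ℝ 1 ψ := (φ n).contDiff_normed
    have hψc : HasCompactSupport ψ := (φ n).hasCompactSupport_normed
    have hswap : ∀ x, convolution ψ u (ContinuousLinearMap.lsmul ℝ ℝ) volume x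
        = convolution u ψ (ContinuousLinearMap.mul ℝ ℝ) volume x := by
      intro x
      rw [convolution_eq_swap]
      simp [convolution, mul_comm]
    simp only [hswap]
    have hder := fun x => hψc.hasFDerivAt_convolution_right (ContinuousLinearMap.mul ℝ ℝ)
      hu.locallyIntegrable hψ1 x
    have hzero : ∀ x, fderiv ℝ (convolution u ψ (ContinuousLinearMap.mul ℝ ℝ) volume) x = 0 := by
      intro x
      rw [(hder x).fderiv]
      refine ContinuousLinearMap.coe_injective
        ((EuclideanSpace.basisFun (Fin d) ℝ).toBasis.ext fun i => ?_)
      simp only [OrthonormalBasis.coe_toBasis, EuclideanSpace.basisFun_apply,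
        ContinuousLinearMap.coe_coe,
        ContinuousLinearMap.toLinearMap_zero, LinearMap.zero_apply]
      rw [convolution_precompR_apply _ hu.locallyIntegrable (hψc.fderiv ℝ)
        (hψ1.continuous_fderiv one_ne_zero)]
      let v : EuclideanSpace ℝ (Fin d) → EuclideanSpace ℝ (Fin d) := fun t =>
        (-ψ (x - t)) • EuclideanSpace.single i (1 : ℝ)
      have hv : IsTestField v := by
        refine ⟨by fun_prop, ?_⟩
        have h1 : HasCompactSupport fun t => ψ (x - t) :=
          hψc.comp_homeomorph (Homeomorph.subLeft x)
        exact (h1.comp_left (g := fun r : ℝ => (-r) • EuclideanSpace.single i (1 : ℝ)) (by simp))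
      have hdiv : ∀ t, divergence v t = fderiv ℝ ψ (x - t) (EuclideanSpace.single i 1) := by
        intro t
        have hd : HasFDerivAt (fun t => ψ (x - t))
            ((fderiv ℝ ψ (x - t)).comp (-ContinuousLinearMap.id ℝ _)) t := by
          have h2 : HasFDerivAt (fun t : EuclideanSpace ℝ (Fin d) => x - t)
            (-ContinuousLinearMap.id ℝ _) t := (hasFDerivAt_id t).const_sub x
          exact ((hψ1.differentiable one_ne_zero) (x - t)).hasFDerivAt.comp t h2
        have hd' := hd.neg.smul_const (EuclideanSpace.single i (1 : ℝ))
        have hd'' : fderiv ℝ v t = _ := hd'.fderiv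
        simp only [divergence, hd'']
        simp
      have := integral_mul_divergence_eq_zero h0 hv
      simp only [hdiv] at this
      simpa [convolution] using this
    intro x
    have hconst := is_const_of_fderiv_eq_zero (𝕜 := ℝ)
      (fun x => (hder x).differentiableAt) hzero x (EuclideanSpace.single (0 : Fin d) (3 : ℝ))
    rw [hconst]
    refine integral_eq_zero_of_ae ?_
    filter_upwards [hc] with t ht
    by_cases htc : t ∈ cube d
    · have h3 : ψ (EuclideanSpace.single (0 : Fin d) (3 : ℝ) - t) = 0 := by
        have : EuclideanSpace.single (0 : Fin d) (3 : ℝ) - t ∉ Function.support ψ := by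
          rw [hψ, ContDiffBump.support_normed_eq, mem_ball_zero_iff, not_lt]
          have h4 := PiLp.norm_apply_le (EuclideanSpace.single (0 : Fin d) (3 : ℝ) - t) 0
          have h5 := (htc 0).2
          have h6 : (φ n).rOut ≤ 1 := by
            simp only [φ]
            rw [div_le_one (by positivity)]
            linarith [(Nat.cast_nonneg n : (0 : ℝ) ≤ n)]
          simp only [PiLp.sub_apply, PiLp.single_apply, if_true, Real.norm_eq_abs] at h4
          have h7 := le_abs_self (3 - t 0)
          linarith
        simpa using this
      simp [h3]
    · simp [ht htc]
  filter_upwards [hae] with x hx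
  simp only [key] at hx
  exact tendsto_nhds_unique hx tendsto_const_nhds

end Helpers

/-- The elements of `BV([0,1]^d)`, as a linear subspace of `L¹(ℝ^d)`: the classes that vanish
almost everywhere outside the cube and have finite variation on `ℝ^d`. -/
def bvSubmodule (d : ℕ) :
    Submodule ℝ (Lp ℝ 1 (volume : Measure (EuclideanSpace ℝ (Fin d)))) where
  carrier := {u | (∀ᵐ x, x ∉ cube d → u x = 0) ∧ deGiorgiVariation u < ∞}
  zero_mem' := by
    have h := Lp.coeFn_zero ℝ 1 (volume : Measure (EuclideanSpace ℝ (Fin d)))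
    refine ⟨?_, ?_⟩
    · filter_upwards [h] with x hx _
      rw [hx, Pi.zero_apply]
    · rw [deGiorgiVariation_congr h]
      exact deGiorgiVariation_zero.trans_lt ENNReal.zero_lt_top
  add_mem' := by
    rintro u w ⟨hu, hu'⟩ ⟨hw, hw'⟩
    refine ⟨?_, ?_⟩
    · filter_upwards [hu, hw, Lp.coeFn_add u w] with x h1 h2 h3 hx
      rw [h3, Pi.add_apply, h1 hx, h2 hx, add_zero]
    · rw [deGiorgiVariation_congr (Lp.coeFn_add u w)]
      exact (deGiorgiVariation_add_le (L1.integrable_coeFn u) (L1.integrable_coeFn w)).trans_lt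
        (ENNReal.add_lt_top.2 ⟨hu', hw'⟩)
  smul_mem' := by
    rintro c u ⟨hu, hu'⟩
    refine ⟨?_, ?_⟩
    · filter_upwards [hu, Lp.coeFn_smul c u] with x h1 h3 hx
      rw [h3, Pi.smul_apply, h1 hx, smul_zero]
    · rw [deGiorgiVariation_congr (Lp.coeFn_smul c u)]
      exact (deGiorgiVariation_smul_le c u).trans_lt
        (ENNReal.mul_lt_top ENNReal.ofReal_lt_top hu')

/-- The space `BV([0,1]^d)`. It is a separate type because its norm is the variation
`‖Du‖(ℝ^d)`, and not the `L¹` norm. -/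
def BV (d : ℕ) : Type := bvSubmodule d

namespace BV

variable {d : ℕ}

/-- The vector space operations are those of `L¹(ℝ^d)`. -/
@[reducible] def addCommGroup : AddCommGroup (BV d) :=
  inferInstanceAs (AddCommGroup (bvSubmodule d))

attribute [local instance] addCommGroup

/-- The vector space operations are those of `L¹(ℝ^d)`. -/
@[reducible] def module : Module ℝ (BV d) := inferInstanceAs (Module ℝ (bvSubmodule d))

attribute [local instance] module

/-- The class in `L¹(ℝ^d)` of an element of `BV([0,1]^d)`. -/
def toL1 (u : BV d) : Lp ℝ 1 (volume : Measure (EuclideanSpace ℝ (Fin d))) :=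
  Subtype.val (p := fun w => w ∈ bvSubmodule d) u

/-- A representative of an element of `BV([0,1]^d)`. -/
instance : CoeFun (BV d) fun _ => EuclideanSpace ℝ (Fin d) → ℝ := ⟨fun u => u.toL1⟩

instance : Norm (BV d) := ⟨fun u => (deGiorgiVariation u).toReal⟩

lemma norm_def (u : BV d) : ‖u‖ = (deGiorgiVariation u).toReal := rfl

lemma integrable (u : BV d) : Integrable u := L1.integrable_coeFn u.toL1

lemma deGiorgiVariation_ne_top (u : BV d) : deGiorgiVariation u ≠ ∞ := u.2.2.ne

lemma coeFn_add (u w : BV d) : (u + w : BV d) =ᵐ[volume] fun x => u x + w x :=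
  Lp.coeFn_add u.toL1 w.toL1

lemma coeFn_smul (c : ℝ) (u : BV d) : (c • u : BV d) =ᵐ[volume] fun x => c * u x :=
  Lp.coeFn_smul c u.toL1

lemma norm_smul_le' (c : ℝ) (u : BV d) : ‖c • u‖ ≤ |c| * ‖u‖ := by
  have h : |c| * ‖u‖ = (ENNReal.ofReal |c| * deGiorgiVariation u).toReal := by
    rw [ENNReal.toReal_mul, ENNReal.toReal_ofReal (abs_nonneg c), norm_def]
  rw [h, norm_def, deGiorgiVariation_congr (coeFn_smul c u)]
  exact ENNReal.toReal_mono
    (ENNReal.mul_ne_top ENNReal.ofReal_ne_top u.deGiorgiVariation_ne_top)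
    (deGiorgiVariation_smul_le c u)

lemma core [NeZero d] : NormedSpace.Core ℝ (BV d) where
  norm_nonneg _ := ENNReal.toReal_nonneg
  norm_smul c u := by
    refine le_antisymm (norm_smul_le' c u) ?_
    rcases eq_or_ne c 0 with rfl | hc
    · simp only [norm_zero, zero_mul]
      exact ENNReal.toReal_nonneg
    · have h := norm_smul_le' c⁻¹ (c • u)
      rw [inv_smul_smul₀ hc, abs_inv, ← div_eq_inv_mul, le_div_iff₀ (abs_pos.2 hc)] at h
      rw [Real.norm_eq_abs, mul_comm]
      exact h
  norm_triangle u w := by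
    rw [norm_def, deGiorgiVariation_congr (coeFn_add u w), norm_def, norm_def,
      ← ENNReal.toReal_add u.deGiorgiVariation_ne_top w.deGiorgiVariation_ne_top]
    exact ENNReal.toReal_mono
      (ENNReal.add_ne_top.2 ⟨u.deGiorgiVariation_ne_top, w.deGiorgiVariation_ne_top⟩)
      (deGiorgiVariation_add_le u.integrable w.integrable)
  norm_eq_zero_iff u := by
    constructor
    · intro h
      rw [norm_def, ENNReal.toReal_eq_zero_iff] at h
      have h1 := ae_eq_zero_of_deGiorgiVariation_eq_zero u.integrable u.2.1
        (h.resolve_right u.deGiorgiVariation_ne_top)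
      exact Subtype.ext ((Lp.eq_zero_iff_ae_eq_zero (f := u.toL1)).2 h1)
    · rintro rfl
      have h : ((0 : BV d) : EuclideanSpace ℝ (Fin d) → ℝ) =ᵐ[volume] fun _ => 0 :=
        Lp.coeFn_zero ℝ 1 (volume : Measure (EuclideanSpace ℝ (Fin d)))
      rw [norm_def, deGiorgiVariation_congr h, deGiorgiVariation_zero, ENNReal.toReal_zero]

instance [NeZero d] : NormedAddCommGroup (BV d) := NormedAddCommGroup.ofCore core

instance [NeZero d] : NormedSpace ℝ (BV d) where
  norm_smul_le c u := norm_smul_le' c u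

end BV

/-- The finite `ℝ^d`-valued measure `μ` is the distributional gradient of `u`:
`∫ u div v = -∫ v · dμ` for all `v ∈ C¹_c(ℝ^d; ℝ^d)`. -/
def IsGradientMeasure {d : ℕ} (u : EuclideanSpace ℝ (Fin d) → ℝ)
    (μ : VectorMeasure (EuclideanSpace ℝ (Fin d)) (EuclideanSpace ℝ (Fin d))) : Prop :=
  IsFiniteMeasure μ.variation ∧
    ∀ v : EuclideanSpace ℝ (Fin d) → EuclideanSpace ℝ (Fin d), IsTestField v →
      ∫ x, u x * divergence v x = -(∫ᵛ x, v x ∂[innerSL ℝ; μ])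

open Classical in
/-- The distributional gradient `Du` (and `0` if there is none). -/
def gradientMeasure {d : ℕ} (u : EuclideanSpace ℝ (Fin d) → ℝ) :
    VectorMeasure (EuclideanSpace ℝ (Fin d)) (EuclideanSpace ℝ (Fin d)) :=
  if h : ∃ μ, IsGradientMeasure u μ then h.choose else 0

/-- The number `(div v)(u) = -∫_{[0,1]^d} v · dDu`, where `v ∈ C([0,1]^d; ℝ^d)`. To be integrated
on the cube, `v` is extended by zero. -/
def divPairing {d : ℕ} (v : C(cube d, EuclideanSpace ℝ (Fin d)))
    (u : EuclideanSpace ℝ (Fin d) → ℝ) : ℝ :=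
  -(∫ᵛ x in cube d, Function.extend Subtype.val v 0 x ∂[innerSL ℝ; gradientMeasure u])

section Helpers

variable {d : ℕ}

instance isFiniteMeasure_variation_gradientMeasure (u : EuclideanSpace ℝ (Fin d) → ℝ) :
    IsFiniteMeasure (gradientMeasure u).variation := by
  unfold gradientMeasure
  split_ifs with h
  · exact h.choose_spec.1
  · rw [VectorMeasure.variation_zero]
    infer_instance

lemma integrableOn_extend (v : C(cube d, EuclideanSpace ℝ (Fin d)))
    (u : EuclideanSpace ℝ (Fin d) → ℝ) :
    (gradientMeasure u).IntegrableOn (Function.extend Subtype.val v 0) (cube d) := by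
  have hcont : ContinuousOn (Function.extend Subtype.val v 0) (cube d) := by
    rw [continuousOn_iff_continuous_domRestrict]
    convert v.continuous using 1
    ext1 x
    exact Subtype.val_injective.extend_apply _ _ x
  unfold VectorMeasure.IntegrableOn VectorMeasure.Integrable
  rw [VectorMeasure.variation_restrict measurableSet_cube]
  exact hcont.integrableOn_compact isCompact_cube

lemma extend_add (v w : C(cube d, EuclideanSpace ℝ (Fin d))) :
    Function.extend Subtype.val (v + w : C(cube d, EuclideanSpace ℝ (Fin d))) 0
      = Function.extend Subtype.val v 0 + Function.extend Subtype.val w 0 := by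
  rw [← Function.extend_add]
  simp

lemma divPairing_add (v w : C(cube d, EuclideanSpace ℝ (Fin d)))
    (u : EuclideanSpace ℝ (Fin d) → ℝ) :
    divPairing (v + w) u = divPairing v u + divPairing w u := by
  simp only [divPairing, extend_add]
  rw [VectorMeasure.integral_add (integrableOn_extend v u) (integrableOn_extend w u), neg_add]

lemma divPairing_smul (c : ℝ) (v : C(cube d, EuclideanSpace ℝ (Fin d)))
    (u : EuclideanSpace ℝ (Fin d) → ℝ) :
    divPairing (c • v) u = c * divPairing v u := by
  have h : Function.extend Subtype.val (c • v : C(cube d, EuclideanSpace ℝ (Fin d))) 0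
      = c • Function.extend Subtype.val v 0 := by
    rw [← Function.extend_smul]
    simp
  simp only [divPairing, h]
  rw [VectorMeasure.integral_smul, smul_eq_mul, mul_neg]

end Helpers

/-- The elements of `CH([0,1]^d)`: the image of `div`, as a linear subspace of
`BV([0,1]^d)^*`. -/
def chSubmodule (d : ℕ) [NeZero d] : Submodule ℝ (StrongDual ℝ (BV d)) where
  carrier := {ω | ∃ v : C(cube d, EuclideanSpace ℝ (Fin d)), ∀ u : BV d, ω u = divPairing v u}
  zero_mem' := by
    refine ⟨0, fun u => ?_⟩
    have h := divPairing_add (0 : C(cube d, EuclideanSpace ℝ (Fin d))) 0 u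
    rw [add_zero, left_eq_add] at h
    exact h.symm
  add_mem' := by
    rintro ω η ⟨v, hv⟩ ⟨w, hw⟩
    exact ⟨v + w, fun u => by rw [divPairing_add, ← hv, ← hw]; rfl⟩
  smul_mem' := by
    rintro c ω ⟨v, hv⟩
    exact ⟨c • v, fun u => by rw [divPairing_smul, ← hv]; rfl⟩

/-- The space `CH([0,1]^d)` of strong charges, with the operator norm of `BV([0,1]^d)^*`. -/
def CH (d : ℕ) [NeZero d] : Type := chSubmodule d

namespace CH

variable {d : ℕ} [NeZero d]

instance : NormedAddCommGroup (CH d) := inferInstanceAs (NormedAddCommGroup (chSubmodule d))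

instance : NormedSpace ℝ (CH d) := inferInstanceAs (NormedSpace ℝ (chSubmodule d))

/-- The inclusion of `CH([0,1]^d)` in `BV([0,1]^d)^*`. -/
def toDual (ω : CH d) : StrongDual ℝ (BV d) :=
  Subtype.val (p := fun η => η ∈ chSubmodule d) ω

instance : CoeFun (CH d) fun _ => BV d → ℝ := ⟨fun ω => ω.toDual⟩

end CH

end BVDuality

end

/-!
`BV([0,1]^d)` is the dual of `CH([0,1]^d)`: the canonical map is isometric because the norm of `u`
is by definition the supremum of `(div v)(u)` over the unit ball of smooth fields `v`
(`norm_canonicalMap`), and the point is that it is onto (`exists_BV_representing`). Completeness of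
`BV` then comes for free, as dual spaces are complete.

Existence of gradients. The functional `v ↦ -∫ u div v` is controlled by the size of `v` on the cube
alone, because a field may be cut off near the cube (`abs_integral_mul_divergence_le`). It therefore
extends to `C([0,1]^d; ℝ^d)`, and a Riesz theorem for vector fields (`exists_integral_inner_eq`)
represents it by a vector measure. The Riesz theorem is reduced to the one for positive functionals:
the total variation `f ↦ sup {T v : |v| ≤ f}` is additive on nonnegative functions, hence given by a
measure `m`; as `|T v| ≤ ∫ |v| dm`, the functional `T` extends to `L²(m)` and has a density there.
The same cutoffs show that `(div v)(u) = ∫ u div v` for test fields `v`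
(`divPairing_restrictCube`), so `div` is a bounded operator `divCH` onto `CH`.

Surjectivity. Let `F` be a functional on `CH`. By the Riesz theorem `F (div v) = ∫ ⟪σ, v⟫ dm` for
some measure `m` on the cube and density `σ`. To recover the function behind `F`, write functions as
divergences by means of the truncated Newtonian field `k(z) = z / (area · |z|^d)` for `|z| < R`,
which is integrable. In polar coordinates `div (k * g)(x)` is `g(x)` minus the mean of `g` over the
sphere of radius `R` around `x` (`divergence_newtonConvolution`). For `g` supported in a fixed ball,
`x` in the cube and `R` large the mean vanishes, so `div (k * g) = g` on the cube and
`F (div (k * g)) = ∫ ⟪σ, k * g⟫ dm = ∫ u g` with `u(y) = ∫ ⟪σ(x), k(x - y)⟫ dm(x)`, an integrable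
function by Fubini's theorem. Applied to `g = div V`, this gives `F (div V) = ∫ u div V`: both
`V` and `k * div V` have the same divergence on the cube, hence the same image in `CH`. This
identity shows at once that `u` has variation at most `‖F‖` and, by density of smooth fields, that
`u` represents `F`.
-/

noncomputable section

namespace BVDuality

/-! ### Riesz representation of functionals on continuous vector fields -/

section Riesz

open scoped NNReal CompactlySupported

variable {X H : Type*} [TopologicalSpace X] [NormedAddCommGroup H]

/-- The values `T v` of a functional at the continuous fields `v` dominated by `f`. -/
def dominatedValues (T : C(X, H) → ℝ) (f : X → ℝ≥0) : Set ℝ :=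
  {r | ∃ v : C(X, H), (∀ x, ‖v x‖ ≤ f x) ∧ T v = r}

lemma zero_mem_dominatedValues {T : C(X, H) → ℝ} (hT : T 0 = 0) (f : X → ℝ≥0) :
    0 ∈ dominatedValues T f :=
  ⟨0, fun x => by simp, hT⟩

/-- The total variation of a functional on continuous fields: `f ↦ sup {T v : |v| ≤ f}`. -/
def totalVariation (T : C(X, H) → ℝ) (f : X → ℝ≥0) : ℝ := sSup (dominatedValues T f)

lemma totalVariation_le {T : C(X, H) → ℝ} (hT : T 0 = 0) {f : X → ℝ≥0} {C : ℝ}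
    (h : ∀ v : C(X, H), (∀ x, ‖v x‖ ≤ f x) → T v ≤ C) : totalVariation T f ≤ C :=
  csSup_le ⟨0, zero_mem_dominatedValues hT f⟩ (by rintro _ ⟨v, hv, rfl⟩; exact h v hv)

variable [InnerProductSpace ℝ H] [CompactSpace X] (T : C(X, H) →L[ℝ] ℝ)

lemma bddAbove_dominatedValues (f : C_c(X, ℝ≥0)) : BddAbove (dominatedValues T f) := by
  obtain ⟨C, hC⟩ := (isCompact_range f.continuous).bddAbove
  refine ⟨‖T‖ * C, ?_⟩
  rintro _ ⟨v, hv, rfl⟩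
  refine (le_abs_self _).trans ((T.le_opNorm v).trans ?_)
  gcongr
  exact (ContinuousMap.norm_le _ C.2).2 fun x =>
    (hv x).trans (NNReal.coe_le_coe.2 (hC (mem_range_self x)))

lemma totalVariation_nonneg (f : C_c(X, ℝ≥0)) : 0 ≤ totalVariation T f :=
  le_csSup (bddAbove_dominatedValues T f) (zero_mem_dominatedValues (map_zero T) f)

lemma le_totalVariation (f : C_c(X, ℝ≥0)) {v : C(X, H)} (hv : ∀ x, ‖v x‖ ≤ f x) :
    T v ≤ totalVariation T f :=
  le_csSup (bddAbove_dominatedValues T f) ⟨v, hv, rfl⟩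

lemma totalVariation_add (f g : C_c(X, ℝ≥0)) :
    totalVariation T (f + g : C_c(X, ℝ≥0)) = totalVariation T f + totalVariation T g := by
  apply le_antisymm
  · refine totalVariation_le (map_zero T) fun v hv => le_of_forall_pos_le_add fun ε hε => ?_
    -- Split `v` in proportion `f : g : δ`; the weight `δ > 0` keeps the quotients continuous.
    set δ : ℝ := ε / (‖T‖ + 1) with hδ
    have hT : 0 < ‖T‖ + 1 := by positivity
    have hδ0 : 0 < δ := by positivity
    have hpos : ∀ x, 0 < (f x : ℝ) + g x + δ := fun x => by positivity
    have hf : Continuous fun x => (f x : ℝ) := by fun_prop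
    have hg : Continuous fun x => (g x : ℝ) := by fun_prop
    have hc : ∀ h : X → ℝ, Continuous h →
        Continuous fun x => (h x / ((f x : ℝ) + g x + δ)) • v x := fun h hh =>
      (hh.div₀ (by fun_prop) fun x => (hpos x).ne').smul v.continuous
    let P : (h : X → ℝ) → Continuous h → C(X, H) := fun h hh => ⟨_, hc h hh⟩
    have hv' : ∀ x, ‖v x‖ ≤ (f x : ℝ) + g x := fun x => by simpa using hv x
    have hP : ∀ (h : X → ℝ) (hh : Continuous h), (∀ x, 0 ≤ h x) → ∀ x, ‖P h hh x‖ ≤ h x := by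
      intro h hh h0 x
      simp only [P, ContinuousMap.coe_mk, norm_smul, Real.norm_eq_abs, abs_div, abs_of_nonneg (h0 x),
        abs_of_pos (hpos x)]
      rw [div_mul_eq_mul_div, div_le_iff₀ (hpos x)]
      exact mul_le_mul_of_nonneg_left ((hv' x).trans (by linarith)) (h0 x)
    have hcδ : Continuous fun _ : X => δ := continuous_const
    have hsum : v = P _ hf + P _ hg + P _ hcδ := by
      ext1 x
      simp only [P, ContinuousMap.add_apply, ContinuousMap.coe_mk, ← add_smul, ← add_div,
        div_self (hpos x).ne', one_smul]
    rw [hsum, map_add, map_add]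
    refine add_le_add (add_le_add (le_totalVariation T f (hP _ hf fun x => by positivity))
      (le_totalVariation T g (hP _ hg fun x => by positivity))) ?_
    refine (le_abs_self _).trans ((T.le_opNorm _).trans ?_)
    calc ‖T‖ * ‖P _ hcδ‖ ≤ (‖T‖ + 1) * δ := by
          gcongr
          · linarith
          · exact (ContinuousMap.norm_le _ hδ0.le).2 (hP _ hcδ fun x => hδ0.le)
      _ = ε := mul_div_cancel₀ _ hT.ne'
  · rw [← le_sub_iff_add_le]
    refine totalVariation_le (map_zero T) fun v hv => ?_
    rw [le_sub_comm]
    refine totalVariation_le (map_zero T) fun w hw => ?_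
    rw [le_sub_iff_add_le, add_comm, ← map_add]
    refine le_totalVariation T (f + g) fun x => (norm_add_le _ _).trans ?_
    simpa using add_le_add (hv x) (hw x)

lemma totalVariation_smul_le (c : ℝ≥0) (f : C_c(X, ℝ≥0)) :
    c * totalVariation T f ≤ totalVariation T (c • f : C_c(X, ℝ≥0)) := by
  rcases eq_or_ne c 0 with rfl | hc
  · simpa using totalVariation_nonneg T (0 : C_c(X, ℝ≥0))
  have hc' : (0 : ℝ) < c := by positivity
  rw [← le_div_iff₀' hc']
  refine totalVariation_le (map_zero T) fun v hv => ?_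
  rw [le_div_iff₀' hc', ← smul_eq_mul, ← map_smul]
  refine le_totalVariation T _ fun x => ?_
  simpa [norm_smul] using mul_le_mul_of_nonneg_left (hv x) c.2

/-- The total variation is a positive linear functional on the cone of nonnegative continuous
functions. -/
def totalVariationLinear : C_c(X, ℝ≥0) →ₗ[ℝ≥0] ℝ≥0 where
  toFun f := ⟨totalVariation T f, totalVariation_nonneg T f⟩
  map_add' f g := NNReal.eq (totalVariation_add T f g)
  map_smul' c f := by
    refine NNReal.eq (le_antisymm ?_ (totalVariation_smul_le T c f))
    rcases eq_or_ne c 0 with rfl | hc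
    · refine totalVariation_le (map_zero T) fun v hv => ?_
      have : v = 0 := by
        ext1 x
        simpa using hv x
      simp [this]
    · have h := totalVariation_smul_le T c⁻¹ (c • f)
      rw [inv_smul_smul₀ hc, NNReal.coe_inv, inv_mul_le_iff₀ (by positivity)] at h
      exact h

variable [T2Space X] [MeasurableSpace X] [BorelSpace X]

/-- The measure representing the total variation of a functional on continuous fields. -/
def totalVariationMeasure : Measure X := NNRealRMK.rieszMeasure (totalVariationLinear T)

instance : (totalVariationMeasure T).Regular :=
  inferInstanceAs (NNRealRMK.rieszMeasure (totalVariationLinear T)).Regular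

instance : IsFiniteMeasure (totalVariationMeasure T) := by
  infer_instance

lemma abs_le_integral_totalVariationMeasure (v : C(X, H)) :
    |T v| ≤ ∫ x, ‖v x‖ ∂totalVariationMeasure T := by
  let f : C_c(X, ℝ≥0) :=
    ⟨⟨fun x => ‖v x‖₊, by fun_prop⟩, HasCompactSupport.of_compactSpace _⟩
  have h : ∫ x, ‖v x‖ ∂totalVariationMeasure T = totalVariation T f :=
    NNRealRMK.integral_rieszMeasure (totalVariationLinear T) f
  rw [h, abs_le']
  refine ⟨le_totalVariation T f fun x => le_rfl, ?_⟩
  rw [← map_neg]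
  exact le_totalVariation T f fun x => (norm_neg (v x)).le

/-- **Riesz representation** for fields: a bounded functional on the continuous fields on a compact
space is integration against a vector density with respect to a finite measure. It extends to
`L²` of its total variation measure, where the density comes from the Fréchet-Riesz theorem. -/
theorem exists_integral_inner_eq [CompleteSpace H] [SecondCountableTopologyEither X H] :
    ∃ (m : Measure X) (σ : X → H), IsFiniteMeasure m ∧ Integrable σ m ∧
      ∀ v : C(X, H), T v = ∫ x, inner ℝ (σ x) (v x) ∂m := by
  set m := totalVariationMeasure T
  let e : C(X, H) →L[ℝ] Lp H 2 m := ContinuousMap.toLp 2 m ℝ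
  have hd : DenseRange e := ContinuousMap.toLp_denseRange H m ℝ (by simp)
  have hnorm : ∀ v : C(X, H), ‖T v‖ ≤
      (m univ ^ (1 / (1 : ℝ≥0∞).toReal - 1 / (2 : ℝ≥0∞).toReal)).toReal * ‖e v‖ := by
    intro v
    refine (abs_le_integral_totalVariationMeasure T v).trans ?_
    have hv : AEStronglyMeasurable v m := v.continuous.aestronglyMeasurable
    rw [integral_norm_eq_lintegral_enorm hv, ← eLpNorm_one_eq_lintegral_enorm, mul_comm,
      Lp.norm_def, eLpNorm_congr_ae (ContinuousMap.coeFn_toLp (p := 2) (𝕜 := ℝ) m v),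
      ← ENNReal.toReal_mul]
    have hfin : eLpNorm v 2 m ≠ ∞ := by
      rw [← eLpNorm_congr_ae (ContinuousMap.coeFn_toLp (p := 2) (𝕜 := ℝ) m v)]
      exact Lp.eLpNorm_ne_top _
    refine ENNReal.toReal_mono (ENNReal.mul_ne_top hfin ?_)
      (eLpNorm_le_eLpNorm_mul_rpow_measure_univ (by norm_num) hv)
    exact ENNReal.rpow_ne_top_of_nonneg (by norm_num) (measure_ne_top m univ)
  have hex := LinearMap.extendOfNorm_eq (f := (T : C(X, H) →ₗ[ℝ] ℝ))
    (e := (e : C(X, H) →ₗ[ℝ] Lp H 2 m)) hd ⟨_, hnorm⟩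
  set S := LinearMap.extendOfNorm (T : C(X, H) →ₗ[ℝ] ℝ) (e : C(X, H) →ₗ[ℝ] Lp H 2 m)
  let σ : Lp H 2 m := (InnerProductSpace.toDual ℝ (Lp H 2 m)).symm S
  refine ⟨m, σ, inferInstance, (Lp.memLp σ).integrable (by norm_num), fun v => ?_⟩
  have h1 : T v = inner ℝ σ (e v) := by
    rw [InnerProductSpace.toDual_symm_apply]
    exact (hex v).symm
  rw [h1, L2.inner_def]
  refine integral_congr_ae ?_
  filter_upwards [ContinuousMap.coeFn_toLp (p := 2) (𝕜 := ℝ) m v] with x hx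
  rw [hx]

end Riesz

/-! ### Integrals against vector measures with a density -/

section WithDensity

variable {X E F G : Type*} {mX : MeasurableSpace X} {m : Measure X}
  [NormedAddCommGroup E] [NormedSpace ℝ E] [NormedAddCommGroup F] [NormedSpace ℝ F]
  [NormedAddCommGroup G] [NormedSpace ℝ G]

lemma isFiniteMeasure_variation_withDensityᵥ [CompleteSpace F] {σ : X → F} (hσ : Integrable σ m) :
    IsFiniteMeasure (m.withDensityᵥ σ).variation := by
  rw [Measure.variation_withDensityᵥ hσ]
  exact isFiniteMeasure_withDensity hσ.2.ne

lemma integrable_bilin_of_bound (B : E →L[ℝ] F →L[ℝ] G) {σ : X → F} (hσ : Integrable σ m)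
    {f : X → E} (hf : StronglyMeasurable f) {C : ℝ} (hC : ∀ x, ‖f x‖ ≤ C) :
    Integrable (fun x => B (f x) (σ x)) m := by
  refine (hσ.norm.const_mul (‖B‖ * C)).mono'
    (B.aestronglyMeasurable_comp₂ hf.aestronglyMeasurable hσ.1) (Eventually.of_forall fun x => ?_)
  refine (B.le_opNorm₂ _ _).trans ?_
  gcongr
  exact hC x

/-- The integral of a bounded field against a vector measure with density. -/
lemma integral_withDensityᵥ [CompleteSpace F] [CompleteSpace G] (B : E →L[ℝ] F →L[ℝ] G)
    {σ : X → F} (hσ : Integrable σ m)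
    {f : X → E} (hf : StronglyMeasurable f) {C : ℝ} (hC : ∀ x, ‖f x‖ ≤ C) :
    ∫ᵛ x, f x ∂[B; m.withDensityᵥ σ] = ∫ x, B (f x) (σ x) ∂m := by
  have := isFiniteMeasure_variation_withDensityᵥ hσ
  have hbdd : ∀ s : SimpleFunc X E, ∃ C, ∀ x, ‖s x‖ ≤ C := fun s => by
    obtain ⟨C, hC⟩ := (s.map norm).exists_forall_le
    exact ⟨C, hC⟩
  have hsimple : ∀ s : SimpleFunc X E,
      ∫ᵛ x, s x ∂[B; m.withDensityᵥ σ] = ∫ x, B (s x) (σ x) ∂m := by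
    intro s
    induction s using SimpleFunc.induction with
    | const c hs =>
      rename_i s
      have h1 : ∀ x, SimpleFunc.piecewise s hs (SimpleFunc.const X c) (SimpleFunc.const X 0) x
          = s.indicator (fun _ => c) x := fun x => by
        by_cases hx : x ∈ s <;> simp [hx]
      have h2 : ∀ x, B (s.indicator (fun _ => c) x) (σ x) = s.indicator (fun x => B c (σ x)) x := by
        intro x
        by_cases hx : x ∈ s <;> simp [hx]
      simp_rw [h1, h2]
      rw [VectorMeasure.integral_indicator_const c hs, withDensityᵥ_apply hσ hs,
        MeasureTheory.integral_indicator hs,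
        ContinuousLinearMap.integral_comp_comm _ hσ.integrableOn]
    | add _ hf hg =>
      rename_i f g _
      obtain ⟨C, hC⟩ := hbdd f
      obtain ⟨D, hD⟩ := hbdd g
      have hfi : (m.withDensityᵥ σ).Integrable f :=
        Integrable.of_bound f.stronglyMeasurable.aestronglyMeasurable C (Eventually.of_forall hC)
      have hgi : (m.withDensityᵥ σ).Integrable g :=
        Integrable.of_bound g.stronglyMeasurable.aestronglyMeasurable D (Eventually.of_forall hD)
      simp only [SimpleFunc.coe_add, Pi.add_apply, map_add, add_apply]
      rw [integral_add (integrable_bilin_of_bound B hσ f.stronglyMeasurable hC)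
        (integrable_bilin_of_bound B hσ g.stronglyMeasurable hD), ← hf, ← hg]
      exact VectorMeasure.integral_add hfi hgi
  have hlim := fun x => hf.tendsto_approxBounded_of_norm_le (hC x)
  rcases isEmpty_or_nonempty X with hX | ⟨⟨x₀⟩⟩
  · have : f = (0 : SimpleFunc X E) := Subsingleton.elim _ _
    rw [this]
    exact hsimple 0
  have hC0 : 0 ≤ C := (norm_nonneg _).trans (hC x₀)
  have hb := fun n x => hf.norm_approxBounded_le hC0 n x
  refine tendsto_nhds_unique
    (VectorMeasure.tendsto_integral_of_dominated_convergence (B := B) (μ := m.withDensityᵥ σ)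
      (fun _ => C)
      (fun n => (hf.approxBounded C n).stronglyMeasurable.aestronglyMeasurable)
      (integrable_const C) (fun n => Eventually.of_forall (hb n)) (Eventually.of_forall hlim)) ?_
  simp only [hsimple]
  refine tendsto_integral_of_dominated_convergence (fun x => ‖B‖ * C * ‖σ x‖)
    (fun n => (integrable_bilin_of_bound B hσ (hf.approxBounded C n).stronglyMeasurable (hb n)).1)
    (hσ.norm.const_mul _) (fun n => Eventually.of_forall fun x => ?_)
    (Eventually.of_forall fun x => ?_)
  · refine (B.le_opNorm₂ _ _).trans ?_
    gcongr
    exact hb n x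
  · exact (((B.flip (σ x)).continuous.tendsto _).comp (hlim x))

end WithDensity

/-! ### Mollification, cutoffs, and density of smooth fields -/

variable {d : ℕ}

lemma IsTestField.continuous {v : EuclideanSpace ℝ (Fin d) → EuclideanSpace ℝ (Fin d)}
    (hv : IsTestField v) : Continuous v :=
  hv.1.continuous

section Mollify

open scoped ContDiff Convolution

/-- A sequence of bump functions at the origin whose supports shrink to it. -/
def shrinkingBump (d n : ℕ) : ContDiffBump (0 : EuclideanSpace ℝ (Fin d)) :=
  ⟨(1 / ((n : ℝ) + 1)) / 2, 1 / ((n : ℝ) + 1), by positivity, half_lt_self (by positivity)⟩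

lemma tendsto_rOut_shrinkingBump :
    Tendsto (fun n => (shrinkingBump d n).rOut) atTop (𝓝 0) :=
  tendsto_one_div_add_atTop_nhds_zero_nat

variable {F : Type*} [NormedAddCommGroup F] [NormedSpace ℝ F]

/-- The mollification of a field by the `n`-th bump function. -/
def mollify (n : ℕ) (W : EuclideanSpace ℝ (Fin d) → F) : EuclideanSpace ℝ (Fin d) → F :=
  (shrinkingBump d n).normed volume ⋆[ContinuousLinearMap.lsmul ℝ ℝ, volume] W

variable {W : EuclideanSpace ℝ (Fin d) → F}

lemma contDiff_mollify [CompleteSpace F] (hW : Continuous W) (n : ℕ) :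
    ContDiff ℝ ∞ (mollify n W) :=
  ((shrinkingBump d n).hasCompactSupport_normed).contDiff_convolution_left _
    (shrinkingBump d n).contDiff_normed hW.locallyIntegrable

lemma hasCompactSupport_mollify (hc : HasCompactSupport W) (n : ℕ) :
    HasCompactSupport (mollify n W) :=
  ((shrinkingBump d n).hasCompactSupport_normed).convolution _ hc

lemma norm_mollify_le [CompleteSpace F] (hW : Continuous W) {C : ℝ} (hC : ∀ x, ‖W x‖ ≤ C)
    (n : ℕ) (x : EuclideanSpace ℝ (Fin d)) : ‖mollify n W x‖ ≤ C := by
  rw [← dist_zero_right]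
  exact dist_convolution_le ((norm_nonneg _).trans (hC x))
    (shrinkingBump d n).support_normed_eq.subset (shrinkingBump d n).nonneg_normed
    (shrinkingBump d n).integral_normed hW.aestronglyMeasurable
    fun y _ => by simpa using hC y

lemma tendsto_mollify [CompleteSpace F] (hW : Continuous W) (x : EuclideanSpace ℝ (Fin d)) :
    Tendsto (fun n => mollify n W x) atTop (𝓝 (W x)) :=
  ContDiffBump.convolution_tendsto_right_of_continuous tendsto_rOut_shrinkingBump hW x

lemma eventually_dist_mollify_le [CompleteSpace F] (hW : Continuous W) (hc : HasCompactSupport W)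
    {ε : ℝ} (hε : 0 < ε) : ∀ᶠ n in atTop, ∀ x, dist (mollify n W x) (W x) ≤ ε := by
  obtain ⟨δ, hδ, h⟩ := Metric.uniformContinuous_iff.1
    (hW.uniformContinuous_of_tendsto_cocompact hc.is_zero_at_infty) ε hε
  filter_upwards [tendsto_rOut_shrinkingBump.eventually (gt_mem_nhds hδ)] with n hn x
  exact (shrinkingBump d n).dist_normed_convolution_le hW.aestronglyMeasurable
    fun y hy => (h ((Metric.mem_ball.1 hy).trans hn)).le

lemma fderiv_mollify [CompleteSpace F] (hW : ContDiff ℝ 1 W) (hc : HasCompactSupport W) (n : ℕ)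
    (x : EuclideanSpace ℝ (Fin d)) : fderiv ℝ (mollify n W) x = mollify n (fderiv ℝ W) x :=
  (hc.hasFDerivAt_convolution_right (ContinuousLinearMap.lsmul ℝ ℝ)
    (shrinkingBump d n).continuous_normed.locallyIntegrable hW x).fderiv

end Mollify

section Cutoff

open scoped ContDiff

/-- A smooth compactly supported function that is `1` near the cube and vanishes off a given
neighbourhood of it. -/
lemma exists_cutoff {U : Set (EuclideanSpace ℝ (Fin d))} (hU : IsOpen U) (hcU : cube d ⊆ U) :
    ∃ χ : EuclideanSpace ℝ (Fin d) → ℝ, ContDiff ℝ ∞ χ ∧ HasCompactSupport χ ∧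
      (∀ x, χ x ∈ Icc (0 : ℝ) 1) ∧ (∀ x ∈ cube d, ∀ᶠ y in 𝓝 x, χ y = 1) ∧ ∀ x ∉ U, χ x = 0 := by
  obtain ⟨ρ, hρ⟩ := (isCompact_cube (d := d)).isBounded.subset_ball (0 : EuclideanSpace ℝ (Fin d))
  obtain ⟨χ, h1, h0, h01⟩ := exists_contMDiffMap_one_nhds_of_subset_interior (n := (⊤ : ℕ∞))
    (modelWithCornersSelf ℝ (EuclideanSpace ℝ (Fin d))) (isCompact_cube (d := d)).isClosed
    (t := U ∩ Metric.ball 0 ρ)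
    (by rw [(hU.inter Metric.isOpen_ball).interior_eq]; exact subset_inter hcU hρ)
  refine ⟨χ, χ.contMDiff.contDiff, ?_, h01, fun x hx => eventually_nhdsSet_iff_forall.1 h1 x hx,
    fun x hx => h0 x fun h => hx h.1⟩
  exact HasCompactSupport.intro (isCompact_closedBall (0 : EuclideanSpace ℝ (Fin d)) ρ)
    fun x hx => h0 x fun h => hx (Metric.ball_subset_closedBall h.2)

lemma divergence_congr {v w : EuclideanSpace ℝ (Fin d) → EuclideanSpace ℝ (Fin d)}
    {x : EuclideanSpace ℝ (Fin d)} (h : v =ᶠ[𝓝 x] w) : divergence v x = divergence w x := by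
  simp only [divergence, h.fderiv_eq]

/-- Cutting a field off near the cube does not change its divergence on the cube. -/
lemma divergence_cutoff {χ : EuclideanSpace ℝ (Fin d) → ℝ}
    (h1 : ∀ x ∈ cube d, ∀ᶠ y in 𝓝 x, χ y = 1)
    (v : EuclideanSpace ℝ (Fin d) → EuclideanSpace ℝ (Fin d))
    {x : EuclideanSpace ℝ (Fin d)} (hx : x ∈ cube d) :
    divergence (fun y => χ y • v y) x = divergence v x :=
  divergence_congr ((h1 x hx).mono fun y hy => by simp [hy])

lemma IsTestField.cutoff {v : EuclideanSpace ℝ (Fin d) → EuclideanSpace ℝ (Fin d)}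
    (hv : ContDiff ℝ 1 v) {χ : EuclideanSpace ℝ (Fin d) → ℝ} (hχ : ContDiff ℝ ∞ χ)
    (hc : HasCompactSupport χ) : IsTestField fun y => χ y • v y :=
  ⟨(hχ.of_le (by simp)).smul hv, hc.smul_right⟩

lemma norm_cutoff_le {t : ℝ} (ht : t ∈ Icc (0 : ℝ) 1) {F : Type*} [NormedAddCommGroup F]
    [NormedSpace ℝ F] (v : F) : ‖t • v‖ ≤ ‖v‖ := by
  rw [norm_smul, Real.norm_of_nonneg ht.1]
  exact mul_le_of_le_one_left (norm_nonneg _) ht.2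

end Cutoff

section Density

open scoped ContDiff

instance : CompactSpace (cube d) := isCompact_iff_compactSpace.1 isCompact_cube

/-- The nearest-point retraction of `ℝ^d` onto the cube. -/
def clampCube (x : EuclideanSpace ℝ (Fin d)) : cube d :=
  ⟨WithLp.toLp 2 fun i => max 0 (min 1 (x i)), fun i => ⟨by simp, by simp⟩⟩

lemma continuous_clampCube : Continuous (clampCube (d := d)) := by
  unfold clampCube
  fun_prop

lemma clampCube_coe (x : cube d) : clampCube (x : EuclideanSpace ℝ (Fin d)) = x := by
  refine Subtype.ext (PiLp.ext fun i => ?_)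
  have h := x.2 i
  simp [clampCube, h.1, h.2]

/-- The restriction of a continuous field to the cube. -/
def restrictCube (v : EuclideanSpace ℝ (Fin d) → EuclideanSpace ℝ (Fin d)) (hv : Continuous v) :
    C(cube d, EuclideanSpace ℝ (Fin d)) :=
  ⟨fun x => v x, by fun_prop⟩

/-- Every continuous field on the cube is the uniform limit of restrictions of smooth compactly
supported fields that obey the same bound on the whole space. -/
lemma exists_smooth_approx (w : C(cube d, EuclideanSpace ℝ (Fin d))) {ε : ℝ} (hε : 0 < ε) :
    ∃ (V : EuclideanSpace ℝ (Fin d) → EuclideanSpace ℝ (Fin d)) (hV : IsTestField V),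
      ContDiff ℝ ∞ V ∧ (∀ x, ‖V x‖ ≤ ‖w‖) ∧
      ‖restrictCube V hV.continuous - w‖ ≤ ε := by
  obtain ⟨χ, hχ, hχc, hχ01, hχ1, -⟩ := exists_cutoff (d := d) isOpen_univ (subset_univ _)
  set W : EuclideanSpace ℝ (Fin d) → EuclideanSpace ℝ (Fin d) :=
    fun x => χ x • w (clampCube x) with hW
  have hWc : Continuous W := hχ.continuous.smul (w.continuous.comp continuous_clampCube)
  have hWs : HasCompactSupport W := hχc.smul_right
  obtain ⟨n, hn⟩ := (eventually_dist_mollify_le hWc hWs hε).exists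
  refine ⟨mollify n W, ⟨(contDiff_mollify hWc n).of_le (by simp), hasCompactSupport_mollify hWs n⟩,
    contDiff_mollify hWc n, norm_mollify_le hWc (fun x => ?_) n, ?_⟩
  · exact (norm_cutoff_le (hχ01 x) _).trans (w.norm_coe_le_norm _)
  · refine (ContinuousMap.norm_le _ hε.le).2 fun x => ?_
    have h : W x = w x := by
      simp [hW, clampCube_coe, (hχ1 x x.2).self_of_nhds]
    rw [ContinuousMap.sub_apply, ← dist_eq_norm, ← h]
    exact hn x

end Density

/-! ### The distributional gradient of a function in `BV` -/

section Pairing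

lemma BV.ae_eq_zero_off_cube (u : BV d) : ∀ᵐ x, x ∉ cube d → u x = 0 := u.2.1


lemma zero_mem_cube : (0 : EuclideanSpace ℝ (Fin d)) ∈ cube d := fun i => by simp

lemma integral_mul_congr_cube {u : EuclideanSpace ℝ (Fin d) → ℝ} (hu : ∀ᵐ x, x ∉ cube d → u x = 0)
    {f g : EuclideanSpace ℝ (Fin d) → ℝ} (h : ∀ x ∈ cube d, f x = g x) :
    ∫ x, u x * f x = ∫ x, u x * g x := by
  refine integral_congr_ae ?_
  filter_upwards [hu] with x hx
  by_cases hxc : x ∈ cube d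
  · rw [h x hxc]
  · simp [hx hxc]

lemma IsTestField.add {v w : EuclideanSpace ℝ (Fin d) → EuclideanSpace ℝ (Fin d)}
    (hv : IsTestField v) (hw : IsTestField w) : IsTestField (v + w) :=
  ⟨hv.1.add hw.1, hv.2.add hw.2⟩

lemma divergence_add {v w : EuclideanSpace ℝ (Fin d) → EuclideanSpace ℝ (Fin d)}
    (hv : IsTestField v) (hw : IsTestField w) (x : EuclideanSpace ℝ (Fin d)) :
    divergence (v + w) x = divergence v x + divergence w x := by
  simp only [divergence]
  rw [fderiv_add ((hv.1.differentiable one_ne_zero) x) ((hw.1.differentiable one_ne_zero) x)]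
  simp [Finset.sum_add_distrib]

lemma abs_integral_mul_divergence_le_of_forall (u : BV d)
    {v : EuclideanSpace ℝ (Fin d) → EuclideanSpace ℝ (Fin d)} (hv : IsTestField v) {C : ℝ}
    (hC0 : 0 < C) (hC : ∀ x, ‖v x‖ ≤ C) : |∫ x, u x * divergence v x| ≤ C * ‖u‖ := by
  have h1 : ∀ x, ‖C⁻¹ • v x‖ ≤ 1 := fun x => by
    rw [norm_smul, norm_inv, Real.norm_of_nonneg hC0.le, inv_mul_le_one₀ hC0]
    exact hC x
  have h := abs_le_deGiorgiVariation u (hv.smul C⁻¹) h1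
  have h2 : ∀ x, u x * (C⁻¹ * divergence v x) = C⁻¹ * (u x * divergence v x) := fun x => by ring
  simp only [divergence_smul hv, h2] at h
  rw [integral_const_mul, abs_mul, abs_of_pos (inv_pos.2 hC0),
    ENNReal.ofReal_le_iff_le_toReal u.deGiorgiVariation_ne_top, ← BV.norm_def,
    inv_mul_le_iff₀ hC0] at h
  exact h

/-- Only the size of the field on the cube matters: a field can be cut off near the cube without
changing the pairing with a function that vanishes off the cube. -/
lemma abs_integral_mul_divergence_le (u : BV d)
    {v : EuclideanSpace ℝ (Fin d) → EuclideanSpace ℝ (Fin d)} (hv : IsTestField v) {C : ℝ}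
    (hC : ∀ x ∈ cube d, ‖v x‖ ≤ C) : |∫ x, u x * divergence v x| ≤ C * ‖u‖ := by
  have hC0 : 0 ≤ C := (norm_nonneg _).trans (hC 0 zero_mem_cube)
  have key : ∀ ε > 0, |∫ x, u x * divergence v x| ≤ (C + ε) * ‖u‖ := by
    intro ε hε
    obtain ⟨χ, hχ, hχc, hχ01, hχ1, hχ0⟩ := exists_cutoff (d := d) (U := {x | ‖v x‖ < C + ε})
      (isOpen_lt hv.continuous.norm continuous_const)
      (fun x hx => (hC x hx).trans_lt (by linarith))
    rw [integral_mul_congr_cube u.ae_eq_zero_off_cube fun x hx => (divergence_cutoff hχ1 v hx).symm]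
    refine abs_integral_mul_divergence_le_of_forall u (.cutoff hv.1 hχ hχc) (by positivity)
      fun x => ?_
    by_cases hx : x ∈ {x | ‖v x‖ < C + ε}
    · exact (norm_cutoff_le (hχ01 x) _).trans (le_of_lt hx)
    · rw [hχ0 x hx, zero_smul, norm_zero]
      positivity
  have hlim : Tendsto (fun ε : ℝ => (C + ε) * ‖u‖) (𝓝[>] 0) (𝓝 ((C + 0) * ‖u‖)) :=
    ((continuous_const.add continuous_id).mul continuous_const).continuousWithinAt
  rw [add_zero] at hlim
  exact ge_of_tendsto hlim (eventually_mem_nhdsWithin.mono fun ε hε => key ε hε)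

end Pairing

section Gradient

/-- The space `C¹_c(ℝ^d; ℝ^d)`. -/
def testFields (d : ℕ) : Submodule ℝ (EuclideanSpace ℝ (Fin d) → EuclideanSpace ℝ (Fin d)) where
  carrier := {v | IsTestField v}
  zero_mem' := isTestField_zero
  add_mem' := IsTestField.add
  smul_mem' c _ hv := hv.smul c

/-- The restriction of test fields to the cube. -/
def testFields.restrict : testFields d →ₗ[ℝ] C(cube d, EuclideanSpace ℝ (Fin d)) where
  toFun v := restrictCube v v.2.continuous
  map_add' _ _ := rfl
  map_smul' _ _ := rfl

lemma denseRange_restrict : DenseRange (testFields.restrict (d := d)) := by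
  refine Metric.denseRange_iff.2 fun w ε hε => ?_
  obtain ⟨V, hV, -, -, h⟩ := exists_smooth_approx w (half_pos hε)
  refine ⟨⟨V, hV⟩, ?_⟩
  rw [dist_comm, dist_eq_norm]
  exact h.trans_lt (half_lt_self hε)

/-- The functional `v ↦ -∫ u div v` on test fields. -/
def gradientFunctional (u : BV d) : testFields d →ₗ[ℝ] ℝ where
  toFun v := -∫ x, u x * divergence v x
  map_add' v w := by
    have h : ∀ x, u x * divergence (v + w : testFields d) x
        = u x * divergence v x + u x * divergence w x := fun x => by
      rw [← mul_add, ← divergence_add v.2 w.2]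
      rfl
    simp only [h]
    rw [integral_add (integrable_mul_divergence u.integrable v.2)
      (integrable_mul_divergence u.integrable w.2), neg_add]
  map_smul' c v := by
    have h : ∀ x, u x * divergence (c • v : testFields d) x = c * (u x * divergence v x) :=
      fun x => by
        rw [mul_left_comm, ← divergence_smul v.2 c]
        rfl
    simp only [h]
    rw [integral_const_mul, RingHom.id_apply, smul_eq_mul, mul_neg]

/-- The functional of an element of `BV` depends only on the values on the cube, extends to
continuous fields there, and is represented by a vector measure. -/
theorem exists_isGradientMeasure (u : BV d) : ∃ μ, IsGradientMeasure u μ := by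
  have hext := LinearMap.extendOfNorm_eq (f := gradientFunctional u) denseRange_restrict
    ⟨‖u‖, fun v => by
      rw [mul_comm, gradientFunctional, LinearMap.coe_mk, AddHom.coe_mk, norm_neg]
      exact abs_integral_mul_divergence_le u v.2 fun x hx =>
        (testFields.restrict v).norm_coe_le_norm ⟨x, hx⟩⟩
  obtain ⟨m, σ, hm, hσ, hT⟩ := exists_integral_inner_eq
    ((gradientFunctional u).extendOfNorm testFields.restrict)
  have hemb : MeasurableEmbedding (Subtype.val : cube d → EuclideanSpace ℝ (Fin d)) :=
    MeasurableEmbedding.subtype_coe measurableSet_cube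
  refine ⟨(m.withDensityᵥ σ).map Subtype.val, ?_, fun v hv => ?_⟩
  · have := isFiniteMeasure_variation_withDensityᵥ hσ
    rw [hemb.variation_map]
    infer_instance
  · obtain ⟨C, hC⟩ := hv.continuous.bounded_above_of_compact_support hv.2
    rw [hemb.integral_map_vectorMeasure, integral_withDensityᵥ (innerSL ℝ) hσ
      (f := fun x : cube d => v x)
      (hv.continuous.comp continuous_subtype_val).stronglyMeasurable (fun x => hC x)]
    have h := (hext ⟨v, hv⟩).symm.trans (hT _)
    rw [← neg_eq_iff_eq_neg]
    refine h.trans (integral_congr_ae (Eventually.of_forall fun x => ?_))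
    exact real_inner_comm _ _

theorem isGradientMeasure_gradientMeasure (u : BV d) :
    IsGradientMeasure u (gradientMeasure u) := by
  rw [gradientMeasure, dif_pos (exists_isGradientMeasure u)]
  exact (exists_isGradientMeasure u).choose_spec

end Gradient

section DivPairing

/-- The gradient measure has no mass off the cube, as far as test fields can see: cutting the field
off near the cube changes nothing on the left, and in the limit restricts the integral to the
cube. -/
lemma divPairing_restrictCube (u : BV d)
    {v : EuclideanSpace ℝ (Fin d) → EuclideanSpace ℝ (Fin d)} (hv : IsTestField v) :
    divPairing (restrictCube v hv.continuous) u = ∫ x, u x * divergence v x := by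
  set μ := gradientMeasure u
  have hμ := isGradientMeasure_gradientMeasure u
  have hU : ∀ n : ℕ, cube d ⊆ Metric.thickening (1 / ((n : ℝ) + 1)) (cube d) := fun n =>
    Metric.self_subset_thickening (by positivity) _
  choose χ hχ hχc hχ01 hχ1 hχ0 using fun n : ℕ => exists_cutoff Metric.isOpen_thickening (hU n)
  have hlim : ∀ x, Tendsto (fun n => χ n x • v x) atTop (𝓝 ((cube d).indicator v x)) := by
    intro x
    by_cases hx : x ∈ cube d
    · simp only [indicator_of_mem hx, (hχ1 _ x hx).self_of_nhds, one_smul]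
      exact tendsto_const_nhds
    · rw [indicator_of_notMem hx]
      have hpos : 0 < Metric.infDist x (cube d) :=
        ((isCompact_cube (d := d)).isClosed.notMem_iff_infDist_pos ⟨0, zero_mem_cube⟩).1 hx
      refine tendsto_const_nhds.congr' ?_
      filter_upwards [tendsto_one_div_add_atTop_nhds_zero_nat.eventually (gt_mem_nhds hpos)]
        with n hn
      rw [hχ0 n x, zero_smul]
      rw [Metric.mem_thickening_iff_infDist_lt ⟨0, zero_mem_cube⟩]
      exact not_lt.2 hn.le
  obtain ⟨C, hC⟩ := hv.continuous.bounded_above_of_compact_support hv.2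
  have hdct := VectorMeasure.tendsto_integral_of_dominated_convergence (B := innerSL ℝ) (μ := μ)
    (fun _ => C) (fun n => ((hχ n).continuous.smul hv.continuous).aestronglyMeasurable)
    (integrable_const C)
    (fun n => Eventually.of_forall fun x => (norm_cutoff_le (hχ01 n x) (v x)).trans (hC x))
    (Eventually.of_forall hlim)
  have hconst : ∀ n, ∫ᵛ x, χ n x • v x ∂[innerSL ℝ; μ] = -∫ x, u x * divergence v x := by
    intro n
    rw [eq_neg_iff_add_eq_zero, add_comm, ← eq_neg_iff_add_eq_zero,
      ← hμ.2 _ (.cutoff hv.1 (hχ n) (hχc n))]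
    exact integral_mul_congr_cube u.ae_eq_zero_off_cube fun x hx =>
      (divergence_cutoff (hχ1 n) v hx).symm
  have h := tendsto_nhds_unique (hdct.congr hconst) tendsto_const_nhds
  rw [divPairing, VectorMeasure.setIntegral_congr_fun (g := v),
    ← VectorMeasure.integral_indicator measurableSet_cube, h, neg_neg]
  intro x hx
  exact Subtype.val_injective.extend_apply (restrictCube v hv.continuous) 0 ⟨x, hx⟩

end DivPairing

/-! ### The divergence operator on continuous fields -/

section DivOperator

lemma abs_divPairing_le_variation (u : EuclideanSpace ℝ (Fin d) → ℝ)
    (w : C(cube d, EuclideanSpace ℝ (Fin d))) :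
    |divPairing w u| ≤
      (‖innerSL ℝ (E := EuclideanSpace ℝ (Fin d))‖ * (gradientMeasure u).variation.real (cube d))
        * ‖w‖ := by
  have hb : ∀ x ∈ cube d, ‖Function.extend Subtype.val w 0 x‖ ≤ ‖w‖ := fun x hx => by
    rw [show x = ((⟨x, hx⟩ : cube d) : EuclideanSpace ℝ (Fin d)) from rfl,
      Subtype.val_injective.extend_apply]
    exact w.norm_coe_le_norm _
  have h := VectorMeasure.norm_setIntegral_le_of_norm_le_const (B := innerSL ℝ)
    (μ := gradientMeasure u) hb
  rw [divPairing, abs_neg, ← Real.norm_eq_abs]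
  exact h.trans (le_of_eq (by ring))

/-- The pairing `v ↦ (div v)(u)`, for a fixed function `u`. -/
def divPairingCLM (u : EuclideanSpace ℝ (Fin d) → ℝ) :
    C(cube d, EuclideanSpace ℝ (Fin d)) →L[ℝ] ℝ :=
  LinearMap.mkContinuous
    { toFun := fun w => divPairing w u
      map_add' := fun v w => divPairing_add v w u
      map_smul' := fun c w => divPairing_smul c w u } _ (abs_divPairing_le_variation u)

lemma divPairingCLM_restrict (u : BV d) (v : testFields d) :
    divPairingCLM u (testFields.restrict v) = ∫ x, u x * divergence v x :=
  divPairing_restrictCube u v.2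

lemma abs_divPairing_le (w : C(cube d, EuclideanSpace ℝ (Fin d))) (u : BV d) :
    |divPairing w u| ≤ ‖w‖ * ‖u‖ := by
  refine denseRange_restrict.induction_on (p := fun w => |divPairingCLM u w| ≤ ‖w‖ * ‖u‖) w
    (isClosed_le (by fun_prop) (by fun_prop)) fun v => ?_
  rw [divPairingCLM_restrict]
  exact abs_integral_mul_divergence_le u v.2 fun x hx =>
    (testFields.restrict v).norm_coe_le_norm ⟨x, hx⟩

variable [NeZero d]

lemma divPairing_add_right (w : C(cube d, EuclideanSpace ℝ (Fin d))) (u u' : BV d) :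
    divPairing w (u + u' : BV d) = divPairing w u + divPairing w u' := by
  refine denseRange_restrict.induction_on
    (p := fun w => divPairingCLM (u + u' : BV d) w = divPairingCLM u w + divPairingCLM u' w) w
    (isClosed_eq (by fun_prop) (by fun_prop)) fun v => ?_
  simp only [divPairingCLM_restrict]
  rw [← integral_add (integrable_mul_divergence u.integrable v.2)
    (integrable_mul_divergence u'.integrable v.2)]
  refine integral_congr_ae ?_
  filter_upwards [BV.coeFn_add u u'] with x hx
  rw [← add_mul, ← hx]

lemma divPairing_smul_right (w : C(cube d, EuclideanSpace ℝ (Fin d))) (c : ℝ) (u : BV d) :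
    divPairing w (c • u : BV d) = c * divPairing w u := by
  refine denseRange_restrict.induction_on
    (p := fun w => divPairingCLM (c • u : BV d) w = c * divPairingCLM u w) w
    (isClosed_eq (by fun_prop) (by fun_prop)) fun v => ?_
  simp only [divPairingCLM_restrict]
  rw [← integral_const_mul]
  refine integral_congr_ae ?_
  filter_upwards [BV.coeFn_smul c u] with x hx
  rw [← mul_assoc, ← hx]

/-- The element `div w` of `BV([0,1]^d)^*`. -/
def divDual (w : C(cube d, EuclideanSpace ℝ (Fin d))) : StrongDual ℝ (BV d) :=
  LinearMap.mkContinuous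
    { toFun := fun u => divPairing w u
      map_add' := divPairing_add_right w
      map_smul' := divPairing_smul_right w } ‖w‖ (abs_divPairing_le w)

/-- The operator `div` from `C([0,1]^d; ℝ^d)` onto `CH([0,1]^d)`. -/
def divCH : C(cube d, EuclideanSpace ℝ (Fin d)) →L[ℝ] CH d :=
  LinearMap.mkContinuous
    (LinearMap.codRestrict (chSubmodule d)
      { toFun := divDual
        map_add' := fun v w => ContinuousLinearMap.ext fun u => divPairing_add v w u
        map_smul' := fun c w => ContinuousLinearMap.ext fun u => divPairing_smul c w u }
      fun w => ⟨w, fun _ => rfl⟩ : C(cube d, EuclideanSpace ℝ (Fin d)) →ₗ[ℝ] CH d) 1 fun w => by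
    rw [one_mul]
    show ‖divDual w‖ ≤ ‖w‖
    exact LinearMap.mkContinuous_norm_le _ (norm_nonneg w) (abs_divPairing_le w)

@[simp] lemma divCH_apply (w : C(cube d, EuclideanSpace ℝ (Fin d))) (u : BV d) :
    divCH w u = divPairing w u :=
  rfl

lemma norm_divCH_le (w : C(cube d, EuclideanSpace ℝ (Fin d))) : ‖divCH w‖ ≤ ‖w‖ :=
  LinearMap.mkContinuous_norm_le _ (norm_nonneg w) (abs_divPairing_le w)

lemma CH.ext {ω η : CH d} (h : ∀ u : BV d, ω u = η u) : ω = η :=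
  Subtype.ext (ContinuousLinearMap.ext h)

lemma divCH_surjective : Function.Surjective (divCH (d := d)) := fun ω => by
  obtain ⟨w, hw⟩ := ω.2
  exact ⟨w, CH.ext fun u => (hw u).symm⟩

end DivOperator

/-! ### Polar coordinates and the Newtonian field -/

section Polar

variable {E : Type*} [NormedAddCommGroup E] [NormedSpace ℝ E] [FiniteDimensional ℝ E]
  [MeasurableSpace E] [BorelSpace E] [Nontrivial E] (μ : Measure E) [μ.IsAddHaarMeasure]

/-- Integration in polar coordinates. -/
lemma integral_eq_integral_toSphere_integral_Ioi {f : E → ℝ} (hf : Integrable f μ) :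
    ∫ x, f x ∂μ = ∫ θ : Metric.sphere (0 : E) 1,
      (∫ r in Ioi (0 : ℝ), r ^ (Module.finrank ℝ E - 1) * f (r • (θ : E))) ∂μ.toSphere := by
  let g : Metric.sphere (0 : E) 1 × Ioi (0 : ℝ) → ℝ := fun p => f ((p.2 : ℝ) • (p.1 : E))
  have hg : ∀ x : ({(0)}ᶜ : Set E), g (homeomorphUnitSphereProd E x) = f x := fun x => by
    have h : ((homeomorphUnitSphereProd E).symm (homeomorphUnitSphereProd E x) : E) = x := by simp
    rw [homeomorphUnitSphereProd_symm_apply_coe] at h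
    simp only [g, h]
  have hmp := μ.measurePreserving_homeomorphUnitSphereProd
  have hemb := (homeomorphUnitSphereProd E).measurableEmbedding
  have hgi : Integrable g (μ.toSphere.prod (.volumeIoiPow (Module.finrank ℝ E - 1))) := by
    rw [← hmp.integrable_comp_emb hemb, Function.comp_def]
    simp only [hg]
    rw [← Function.comp_def f, ← integrableOn_iff_comap_subtypeVal (measurableSet_singleton _).compl]
    exact hf.integrableOn
  calc ∫ x, f x ∂μ = ∫ x : ({(0)}ᶜ : Set E), f x ∂(μ.comap (↑)) := by
        rw [integral_subtype_comap (measurableSet_singleton _).compl f,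
          restrict_compl_singleton]
    _ = ∫ p, g p ∂μ.toSphere.prod (.volumeIoiPow (Module.finrank ℝ E - 1)) := by
        rw [← hmp.integral_comp hemb g]
        simp only [hg]
    _ = _ := by
        rw [integral_prod _ hgi]
        congr 1 with θ
        simp only [Measure.volumeIoiPow, ENNReal.ofReal, g]
        rw [integral_withDensity_eq_integral_smul
            ((measurable_subtype_coe.pow_const _).real_toNNReal),
          integral_subtype_comap measurableSet_Ioi fun a : ℝ =>
            Real.toNNReal (a ^ (Module.finrank ℝ E - 1)) • f (a • (θ : E))]
        refine setIntegral_congr_fun measurableSet_Ioi fun x hx => ?_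
        simp only [NNReal.smul_def, smul_eq_mul]
        rw [Real.coe_toNNReal _ (pow_nonneg hx.out.le _)]

end Polar

section Kernel

open scoped Convolution

/-- The area of the unit sphere of `ℝ^d`. -/
def sphereArea (d : ℕ) : ℝ :=
  (volume : Measure (EuclideanSpace ℝ (Fin d))).toSphere.real univ

/-- The truncated Newtonian field `z / (area · |z|^d)` on the ball of radius `R`, and `0` off it:
its divergence is the unit mass at the origin minus the uniform probability on the sphere of
radius `R`. -/
def newtonField (d : ℕ) (R : ℝ) : EuclideanSpace ℝ (Fin d) → EuclideanSpace ℝ (Fin d) :=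
  (Metric.ball 0 R).indicator fun z => (sphereArea d)⁻¹ • (‖z‖ ^ d)⁻¹ • z

lemma measurable_newtonField (R : ℝ) : Measurable (newtonField d R) :=
  Measurable.indicator (by fun_prop) Metric.isOpen_ball.measurableSet

lemma hasCompactSupport_newtonField (R : ℝ) : HasCompactSupport (newtonField d R) :=
  HasCompactSupport.intro (isCompact_closedBall (0 : EuclideanSpace ℝ (Fin d)) R)
    fun _ hx => indicator_of_notMem (fun h => hx (Metric.ball_subset_closedBall h)) _

/-- The divergence as a continuous linear functional of the derivative. -/
def traceCLM (d : ℕ) :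
    (EuclideanSpace ℝ (Fin d) →L[ℝ] EuclideanSpace ℝ (Fin d)) →L[ℝ] ℝ :=
  ∑ i, (EuclideanSpace.proj i).comp
    (ContinuousLinearMap.apply ℝ (EuclideanSpace ℝ (Fin d)) (EuclideanSpace.single i (1 : ℝ)))

lemma traceCLM_fderiv (v : EuclideanSpace ℝ (Fin d) → EuclideanSpace ℝ (Fin d))
    (x : EuclideanSpace ℝ (Fin d)) : traceCLM d (fderiv ℝ v x) = divergence v x := by
  simp [traceCLM, divergence]

lemma traceCLM_precompR (z : EuclideanSpace ℝ (Fin d)) (A : EuclideanSpace ℝ (Fin d) →L[ℝ] ℝ) :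
    traceCLM d ((ContinuousLinearMap.lsmul ℝ ℝ).flip.precompR (EuclideanSpace ℝ (Fin d)) z A)
      = A z := by
  have hz : z = ∑ i, z i • EuclideanSpace.single i (1 : ℝ) := by
    ext j
    simp [Finset.sum_apply, Pi.single_apply]
  conv_rhs => rw [hz, map_sum]
  simp [traceCLM, mul_comm]

variable [NeZero d]

lemma sphereArea_pos : 0 < sphereArea d := by
  rw [sphereArea, measureReal_def]
  refine ENNReal.toReal_pos ?_ (measure_ne_top _ _)
  rw [Ne, Measure.measure_univ_eq_zero]
  exact Measure.toSphere_ne_zero _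

lemma integrable_newtonField (R : ℝ) : Integrable (newtonField d R) := by
  have hint : IntegrableOn (fun z : EuclideanSpace ℝ (Fin d) => (‖z‖ ^ (d - 1))⁻¹)
      (Metric.ball 0 R) := by
    refine (integrableOn_fun_norm_addHaar volume (f := fun y : ℝ => (y ^ (d - 1))⁻¹)).2 ?_
    rw [finrank_euclideanSpace_fin]
    refine (integrableOn_const (C := (1 : ℝ)) (by simp)).congr_fun (fun y hy => ?_) measurableSet_Ioo
    rw [smul_eq_mul, mul_inv_cancel₀ (pow_pos hy.1 _).ne']
  refine Integrable.mono' ((hint.integrable_indicator Metric.isOpen_ball.measurableSet).const_mul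
    (sphereArea d)⁻¹) (measurable_newtonField R).aestronglyMeasurable
    (Eventually.of_forall fun z => ?_)
  by_cases hz : z ∈ Metric.ball 0 R
  · rw [newtonField, indicator_of_mem hz, indicator_of_mem hz, norm_smul, norm_smul, norm_inv,
      norm_inv, norm_pow, norm_norm, Real.norm_of_nonneg sphereArea_pos.le]
    refine mul_le_mul_of_nonneg_left ?_ (inv_nonneg.2 sphereArea_pos.le)
    rcases eq_or_ne z 0 with rfl | hz0
    · simp
    · have hz' : ‖z‖ ≠ 0 := norm_ne_zero_iff.2 hz0
      rw [← pow_sub_one_mul (NeZero.ne d) ‖z‖, mul_inv, mul_assoc, inv_mul_cancel₀ hz', mul_one]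
  · simp [newtonField, hz]

/-- The field `k * g`, for the truncated Newtonian field `k`. -/
def newtonConvolution (R : ℝ) (g : EuclideanSpace ℝ (Fin d) → ℝ) :
    EuclideanSpace ℝ (Fin d) → EuclideanSpace ℝ (Fin d) :=
  newtonField d R ⋆[(ContinuousLinearMap.lsmul ℝ ℝ).flip, volume] g

variable {g : EuclideanSpace ℝ (Fin d) → ℝ}

lemma isTestField_newtonConvolution (R : ℝ) (hg : ContDiff ℝ 1 g) (hc : HasCompactSupport g) :
    IsTestField (newtonConvolution R g) :=
  ⟨hc.contDiff_convolution_right (n := 1) _ (integrable_newtonField R).locallyIntegrable hg,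
    (hasCompactSupport_newtonField R).convolution _ hc⟩

/-- In polar coordinates the singularity of the kernel cancels, and along each ray the derivative
of `g` integrates to a difference of two values. -/
lemma divergence_newtonConvolution {R : ℝ} (hR : 0 < R) (hg : ContDiff ℝ 1 g)
    (hc : HasCompactSupport g) {x : EuclideanSpace ℝ (Fin d)}
    (hx : ∀ θ : EuclideanSpace ℝ (Fin d), ‖θ‖ = 1 → g (x - R • θ) = 0) :
    divergence (newtonConvolution R g) x = g x := by
  have hk := (integrable_newtonField (d := d) R).locallyIntegrable
  have hex := (hc.fderiv ℝ).convolutionExists_right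
    ((ContinuousLinearMap.lsmul ℝ ℝ).flip.precompR (EuclideanSpace ℝ (Fin d))) hk
    (hg.continuous_fderiv one_ne_zero) x
  have hint : Integrable fun t => fderiv ℝ g (x - t) (newtonField d R t) :=
    ((traceCLM d).integrable_comp hex).congr
      (Eventually.of_forall fun t => traceCLM_precompR _ _)
  have h1 : divergence (newtonConvolution R g) x
      = ∫ t, fderiv ℝ g (x - t) (newtonField d R t) := by
    rw [← traceCLM_fderiv, newtonConvolution, (hc.hasFDerivAt_convolution_right _ hk hg x).fderiv,
      convolution_def, ← ContinuousLinearMap.integral_comp_comm _ hex]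
    exact integral_congr_ae (Eventually.of_forall fun t => traceCLM_precompR _ _)
  have hray : ∀ θ : Metric.sphere (0 : EuclideanSpace ℝ (Fin d)) 1,
      ∫ r in Ioi (0 : ℝ), r ^ (d - 1) * fderiv ℝ g (x - r • (θ : EuclideanSpace ℝ (Fin d)))
        (newtonField d R (r • (θ : EuclideanSpace ℝ (Fin d)))) = (sphereArea d)⁻¹ * g x := by
    intro θ
    have hθ : ‖(θ : EuclideanSpace ℝ (Fin d))‖ = 1 := by simp
    have hder : ∀ r ∈ uIcc 0 R, HasDerivAt
        (fun r : ℝ => -g (x - r • (θ : EuclideanSpace ℝ (Fin d))))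
        (fderiv ℝ g (x - r • (θ : EuclideanSpace ℝ (Fin d))) θ) r := by
      intro r _
      have h2 : HasDerivAt (fun r : ℝ => x - r • (θ : EuclideanSpace ℝ (Fin d)))
          (-(θ : EuclideanSpace ℝ (Fin d))) r := by
        simpa using ((hasDerivAt_id r).smul_const (θ : EuclideanSpace ℝ (Fin d))).const_sub x
      simpa [Function.comp_def] using
        ((hg.differentiable one_ne_zero _).hasFDerivAt.comp_hasDerivAt r h2).fun_neg
    have hcont : Continuous fun r : ℝ =>
        fderiv ℝ g (x - r • (θ : EuclideanSpace ℝ (Fin d))) θ := by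
      have := hg.continuous_fderiv one_ne_zero
      fun_prop
    have hval : ∀ r ∈ Ioi (0 : ℝ),
        r ^ (d - 1) * fderiv ℝ g (x - r • (θ : EuclideanSpace ℝ (Fin d)))
          (newtonField d R (r • (θ : EuclideanSpace ℝ (Fin d))))
        = (Iio R).indicator (fun r => (sphereArea d)⁻¹ *
            fderiv ℝ g (x - r • (θ : EuclideanSpace ℝ (Fin d))) θ) r := by
      intro r hr
      have hr0 : (0 : ℝ) < r := hr
      have hnorm : ‖r • (θ : EuclideanSpace ℝ (Fin d))‖ = r := by
        rw [norm_smul, hθ, mul_one, Real.norm_of_nonneg hr0.le]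
      by_cases hrR : r < R
      · have hmem : r • (θ : EuclideanSpace ℝ (Fin d)) ∈ Metric.ball 0 R := by
          rwa [mem_ball_zero_iff, hnorm]
        rw [indicator_of_mem (mem_Iio.2 hrR), newtonField, indicator_of_mem hmem, hnorm]
        simp only [map_smul, smul_eq_mul]
        have h3 : r ^ (d - 1) * (r ^ d)⁻¹ * r = 1 := by
          rw [mul_right_comm, pow_sub_one_mul (NeZero.ne d), mul_inv_cancel₀ (pow_pos hr0 d).ne']
        linear_combination ((sphereArea d)⁻¹ *
          fderiv ℝ g (x - r • (θ : EuclideanSpace ℝ (Fin d))) θ) * h3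
      · have hmem : r • (θ : EuclideanSpace ℝ (Fin d)) ∉ Metric.ball 0 R := by
          rwa [mem_ball_zero_iff, hnorm]
        rw [indicator_of_notMem (by simpa using hrR), newtonField, indicator_of_notMem hmem,
          map_zero, mul_zero]
    rw [setIntegral_congr_fun measurableSet_Ioi hval, setIntegral_indicator measurableSet_Iio,
      Ioi_inter_Iio, ← integral_Ioc_eq_integral_Ioo, ← intervalIntegral.integral_of_le hR.le,
      intervalIntegral.integral_const_mul,
      intervalIntegral.integral_eq_sub_of_hasDerivAt hder (hcont.intervalIntegrable _ _),
      hx _ hθ]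
    simp
  rw [h1, integral_eq_integral_toSphere_integral_Ioi volume hint, finrank_euclideanSpace_fin]
  simp only [hray]
  rw [integral_const, smul_eq_mul]
  exact mul_inv_cancel_left₀ (sphereArea_pos (d := d)).ne' _

end Kernel

/-! ### Functionals on `CH` are functions in `BV`, and the duality -/

section Representation

open scoped ContDiff Convolution

section Fubini

variable {X : Type*} [MeasurableSpace X] {m : Measure X}
  {σ : X → EuclideanSpace ℝ (Fin d)} {p : X → EuclideanSpace ℝ (Fin d)}
  {k : EuclideanSpace ℝ (Fin d) → EuclideanSpace ℝ (Fin d)}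

lemma integrable_inner_translate (hσ : Integrable σ m) (hp : Measurable p) (hk : Integrable k)
    (hkm : Measurable k) :
    Integrable (fun q : X × EuclideanSpace ℝ (Fin d) => inner ℝ (σ q.1) (k (p q.1 - q.2)))
      (m.prod volume) := by
  have hkm' : Measurable fun q : X × EuclideanSpace ℝ (Fin d) => k (p q.1 - q.2) :=
    hkm.comp ((hp.comp measurable_fst).sub measurable_snd)
  have hmeas : AEStronglyMeasurable
      (fun q : X × EuclideanSpace ℝ (Fin d) => inner ℝ (σ q.1) (k (p q.1 - q.2)))
      (m.prod volume) := hσ.1.comp_fst.inner hkm'.aestronglyMeasurable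
  have hbound : ∀ x, ∫ y, ‖inner ℝ (σ x) (k (p x - y))‖ ≤ ‖σ x‖ * ∫ y, ‖k y‖ := fun x => by
    rw [← integral_sub_left_eq_self (fun y => ‖k y‖) volume (p x), ← integral_const_mul]
    exact integral_mono_of_nonneg (Eventually.of_forall fun y => norm_nonneg _)
      ((hk.comp_sub_left (p x)).norm.const_mul _)
      (Eventually.of_forall fun y => norm_inner_le_norm _ _)
  refine (integrable_prod_iff hmeas).2 ⟨Eventually.of_forall fun x =>
    (hk.comp_sub_left (p x)).const_inner (𝕜 := ℝ) (σ x), ?_⟩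
  refine (hσ.norm.mul_const (∫ y, ‖k y‖)).mono' hmeas.norm.integral_prod_right'
    (Eventually.of_forall fun x => ?_)
  rw [Real.norm_of_nonneg (integral_nonneg fun y => norm_nonneg _)]
  exact hbound x

lemma integral_mul_integral_inner_translate [SFinite m] (hσ : Integrable σ m) (hp : Measurable p)
    (hk : Integrable k) (hkm : Measurable k) {g : EuclideanSpace ℝ (Fin d) → ℝ}
    (hg : Continuous g) (hc : HasCompactSupport g) :
    ∫ y, (∫ x, inner ℝ (σ x) (k (p x - y)) ∂m) * g y
      = ∫ x, inner ℝ (σ x) ((k ⋆[(ContinuousLinearMap.lsmul ℝ ℝ).flip, volume] g) (p x)) ∂m := by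
  obtain ⟨C, hC⟩ := hg.bounded_above_of_compact_support hc
  have hint := (integrable_inner_translate hσ hp hk hkm).mul_bdd (c := C)
    hg.aestronglyMeasurable.comp_snd (Eventually.of_forall fun q => hC q.2)
  calc ∫ y, (∫ x, inner ℝ (σ x) (k (p x - y)) ∂m) * g y
      = ∫ y, (∫ x, inner ℝ (σ x) (k (p x - y)) * g y ∂m) := by
        simp only [integral_mul_const]
    _ = ∫ x, (∫ y, inner ℝ (σ x) (k (p x - y)) * g y) ∂m := (integral_integral_swap hint).symm
    _ = _ := by
        refine integral_congr_ae (Eventually.of_forall fun x => ?_)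
        have hx : Integrable fun y => g y • k (p x - y) :=
          (hk.comp_sub_left (p x)).bdd_smul C hg.aestronglyMeasurable
            (Eventually.of_forall hC)
        simp only [convolution_eq_swap, ContinuousLinearMap.flip_apply,
          ContinuousLinearMap.lsmul_apply]
        rw [← integral_inner hx]
        simp only [inner_smul_right, mul_comm]

end Fubini

lemma contDiff_divergence {V : EuclideanSpace ℝ (Fin d) → EuclideanSpace ℝ (Fin d)}
    (hV : ContDiff ℝ ∞ V) : ContDiff ℝ 1 (divergence V) := by
  have h : divergence V = fun x => traceCLM d (fderiv ℝ V x) :=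
    funext fun x => (traceCLM_fderiv V x).symm
  rw [h]
  exact (traceCLM d).contDiff.comp ((contDiff_infty_iff_fderiv.1 hV).2.of_le (by simp))

/-- In the De Giorgi variation of an integrable function, smooth fields suffice. -/
lemma deGiorgiVariation_le_of_smooth {u : EuclideanSpace ℝ (Fin d) → ℝ} (hu : Integrable u) {C : ℝ}
    (h : ∀ V : EuclideanSpace ℝ (Fin d) → EuclideanSpace ℝ (Fin d), IsTestField V →
      ContDiff ℝ ∞ V → (∀ x, ‖V x‖ ≤ 1) → ∫ x, u x * divergence V x ≤ C) :
    deGiorgiVariation u ≤ ENNReal.ofReal C := by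
  refine iSup₂_le fun v ⟨hv, hv1⟩ => ENNReal.ofReal_le_ofReal ?_
  have hdc : Continuous (fderiv ℝ v) := hv.1.continuous_fderiv one_ne_zero
  obtain ⟨D, hD⟩ := hdc.bounded_above_of_compact_support (hv.2.fderiv ℝ)
  have hmol : ∀ n, IsTestField (mollify n v) := fun n =>
    ⟨(contDiff_mollify hv.continuous n).of_le (by simp), hasCompactSupport_mollify hv.2 n⟩
  have hdiv : ∀ n x, divergence (mollify n v) x = traceCLM d (mollify n (fderiv ℝ v) x) :=
    fun n x => by rw [← traceCLM_fderiv, fderiv_mollify hv.1 hv.2]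
  have hlim : Tendsto (fun n => ∫ x, u x * divergence (mollify n v) x) atTop
      (𝓝 (∫ x, u x * divergence v x)) := by
    refine tendsto_integral_of_dominated_convergence (fun x => ‖u x‖ * (‖traceCLM d‖ * D))
      (fun n => (integrable_mul_divergence hu (hmol n)).1) (hu.norm.mul_const _)
      (fun n => Eventually.of_forall fun x => ?_) (Eventually.of_forall fun x => ?_)
    · rw [norm_mul, hdiv]
      gcongr
      refine ((traceCLM d).le_opNorm _).trans ?_
      gcongr
      exact norm_mollify_le hdc hD n x
    · simp only [hdiv]
      rw [← traceCLM_fderiv]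
      exact (((traceCLM d).continuous.tendsto _).comp (tendsto_mollify hdc x)).const_mul _
  exact le_of_tendsto' hlim fun n => h _ (hmol n) (contDiff_mollify hv.continuous n)
    (norm_mollify_le hv.continuous hv1 n)

variable [NeZero d]

/-- A functional on `CH` is represented, against the functions `g` supported in a given ball, by an
integrable function. Such a `g` is the divergence on the cube of the field `k * g`, at which the
functional is given by a measure; moving the kernel `k` over to the measure gives the function. -/
lemma exists_integrable_representing (F : StrongDual ℝ (CH d)) {ρ : ℝ} (hρ : 0 < ρ)
    (hcube : ∀ x ∈ cube d, ‖x‖ ≤ ρ) :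
    ∃ u : EuclideanSpace ℝ (Fin d) → ℝ, Integrable u ∧
      ∀ g : EuclideanSpace ℝ (Fin d) → ℝ, ContDiff ℝ 1 g → HasCompactSupport g →
        (∀ x, ρ + 2 ≤ ‖x‖ → g x = 0) → ∃ w : C(cube d, EuclideanSpace ℝ (Fin d)),
          (∀ u' : BV d, divPairing w u' = ∫ x, u' x * g x) ∧ ∫ x, u x * g x = F (divCH w) := by
  obtain ⟨m, σ, hm, hσ, hT⟩ := exists_integral_inner_eq (F.comp divCH)
  -- On the sphere of radius `R` around a point of the cube, `g` vanishes.
  set R := 2 * ρ + 2 with hR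
  have hk := integrable_newtonField (d := d) R
  have hkm := measurable_newtonField (d := d) R
  refine ⟨fun y => ∫ x, inner ℝ (σ x) (newtonField d R (x - y)) ∂m,
    (integrable_inner_translate hσ measurable_subtype_coe hk hkm).integral_prod_right,
    fun g hg hc hg0 => ?_⟩
  have hw := isTestField_newtonConvolution R hg hc
  refine ⟨restrictCube _ hw.continuous, fun u' => ?_, ?_⟩
  · rw [divPairing_restrictCube u' hw]
    refine integral_mul_congr_cube u'.ae_eq_zero_off_cube fun x hx =>
      divergence_newtonConvolution (by positivity) hg hc fun θ hθ => hg0 _ ?_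
    have h1 : ‖R • θ‖ = R := by
      rw [norm_smul, hθ, mul_one, Real.norm_of_nonneg (by positivity)]
    have h2 := norm_sub_norm_le (R • θ) x
    rw [norm_sub_rev, h1] at h2
    linarith [hcube x hx]
  · rw [integral_mul_integral_inner_translate hσ measurable_subtype_coe hk hkm hg.continuous hc]
    exact (hT (restrictCube _ hw.continuous)).symm

/-- A functional on `CH` is represented by an integrable function supported on the cube. -/
lemma exists_integral_mul_divergence_eq (F : StrongDual ℝ (CH d)) :
    ∃ u : EuclideanSpace ℝ (Fin d) → ℝ, Integrable u ∧ (∀ x ∉ cube d, u x = 0) ∧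
      ∀ (V : EuclideanSpace ℝ (Fin d) → EuclideanSpace ℝ (Fin d)) (hV : IsTestField V),
        ContDiff ℝ ∞ V →
          ∫ x, u x * divergence V x = F (divCH (restrictCube V hV.continuous)) := by
  obtain ⟨ρ, hρ, hcube⟩ := (isCompact_cube (d := d)).isBounded.exists_pos_norm_le
  obtain ⟨u₀, hu₀, hrep⟩ := exists_integrable_representing F hρ hcube
  -- `u₀` vanishes off the cube, as functions supported off the cube are zero in `CH`.
  have hzero : ∀ᵐ x, x ∈ Metric.ball 0 (ρ + 2) \ cube d → u₀ x = 0 := by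
    refine (Metric.isOpen_ball.sdiff
      isCompact_cube.isClosed).ae_eq_zero_of_integral_contDiff_smul_eq_zero
      (hu₀.locallyIntegrable.locallyIntegrableOn _) fun g hg hc hsupp => ?_
    have hg0 : ∀ x, x ∉ Metric.ball 0 (ρ + 2) \ cube d → g x = 0 := fun x hx =>
      image_eq_zero_of_notMem_tsupport fun h => hx (hsupp h)
    obtain ⟨w, hw, hwu⟩ := hrep g (hg.of_le (by simp)) hc fun x hx =>
      hg0 x fun h => (mem_ball_zero_iff.1 h.1).not_ge hx
    have hw0 : divCH w = 0 := CH.ext fun u' => by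
      rw [divCH_apply, hw, integral_mul_congr_cube u'.ae_eq_zero_off_cube
        (g := fun _ => 0) fun x hx => hg0 x fun h => h.2 hx]
      simp only [mul_zero, integral_zero]
      rfl
    rw [hw0, map_zero] at hwu
    simpa only [smul_eq_mul, mul_comm] using hwu
  refine ⟨(cube d).indicator u₀, hu₀.indicator measurableSet_cube,
    fun x hx => indicator_of_notMem hx _, fun V hV hVs => ?_⟩
  obtain ⟨χ, hχ, hχc, -, hχ1, hχ0⟩ := exists_cutoff (d := d) (U := Metric.ball 0 (ρ + 1))
    Metric.isOpen_ball fun x hx => mem_ball_zero_iff.2 ((hcube x hx).trans_lt (by linarith))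
  have hV' : IsTestField fun y => χ y • V y := .cutoff hV.1 hχ hχc
  have hVs' : ContDiff ℝ ∞ fun y => χ y • V y := hχ.smul hVs
  have hg0 : ∀ x, ρ + 2 ≤ ‖x‖ → divergence (fun y => χ y • V y) x = 0 := by
    intro x hx
    have h0 : (fun y => χ y • V y) =ᶠ[𝓝 x] fun _ => 0 := by
      filter_upwards [(isOpen_lt continuous_const continuous_norm).mem_nhds
        (show ρ + 1 < ‖x‖ by linarith)] with y hy
      rw [hχ0 y fun h => (mem_ball_zero_iff.1 h).not_gt hy, zero_smul]
    rw [divergence_congr h0]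
    simp [divergence]
  obtain ⟨w, hw, hwu⟩ := hrep _ (contDiff_divergence hVs')
    (hasCompactSupport_divergence hV') hg0
  have hwV : divCH w = divCH (restrictCube V hV.continuous) := CH.ext fun u' => by
    rw [divCH_apply, divCH_apply, hw, divPairing_restrictCube u' hV]
    exact integral_mul_congr_cube u'.ae_eq_zero_off_cube fun x hx => divergence_cutoff hχ1 V hx
  rw [← hwV, ← hwu]
  refine integral_congr_ae ?_
  filter_upwards [hzero] with x hx
  by_cases hxc : x ∈ cube d
  · rw [indicator_of_mem hxc, divergence_cutoff hχ1 V hxc]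
  · rw [indicator_of_notMem hxc, zero_mul]
    by_cases hxb : ‖x‖ < ρ + 2
    · rw [hx ⟨mem_ball_zero_iff.2 hxb, hxc⟩, zero_mul]
    · rw [hg0 x (not_lt.1 hxb), mul_zero]

/-- Every functional on `CH` is the evaluation at an element of `BV`. -/
theorem exists_BV_representing (F : StrongDual ℝ (CH d)) :
    ∃ u : BV d, ∀ η : CH d, F η = η u := by
  obtain ⟨u₀, hu₀, hsupp, hrep⟩ := exists_integral_mul_divergence_eq F
  have hvar : deGiorgiVariation u₀ ≤ ENNReal.ofReal ‖F‖ := by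
    refine deGiorgiVariation_le_of_smooth hu₀ fun V hV hVs hV1 => ?_
    rw [hrep V hV hVs]
    refine (le_abs_self _).trans ((F.le_opNorm _).trans (mul_le_of_le_one_right (norm_nonneg _) ?_))
    exact (norm_divCH_le _).trans ((ContinuousMap.norm_le _ zero_le_one).2 fun x => hV1 x)
  have hae := hu₀.coeFn_toL1
  let u : BV d := (⟨hu₀.toL1 u₀, by
      filter_upwards [hae] with x hx hxc
      rw [hx, hsupp x hxc], by
      rw [deGiorgiVariation_congr hae]
      exact hvar.trans_lt ENNReal.ofReal_lt_top⟩ : bvSubmodule d)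
  refine ⟨u, fun η => ?_⟩
  obtain ⟨w, rfl⟩ := divCH_surjective η
  have hclosed : IsClosed {w | F (divCH w) = divPairingCLM u w} :=
    isClosed_eq (F.continuous.comp divCH.continuous) (divPairingCLM u).continuous
  refine hclosed.closure_subset (Metric.mem_closure_iff.2 fun ε hε => ?_)
  obtain ⟨V, hV, hVs, -, hVw⟩ := exists_smooth_approx w (half_pos hε)
  refine ⟨restrictCube V hV.continuous, ?_, ?_⟩
  · have h : divPairingCLM u (restrictCube V hV.continuous) = ∫ x, u₀ x * divergence V x := by
      refine (divPairing_restrictCube u hV).trans (integral_congr_ae ?_)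
      filter_upwards [hae] with x hx
      rw [← hx]
      rfl
    exact (hrep V hV hVs).symm.trans h.symm
  · rw [dist_comm, dist_eq_norm]
    exact hVw.trans_lt (half_lt_self hε)

end Representation

section Duality

variable [NeZero d]

/-- The canonical map `Υ(u)(ω) = ω(u)` from `BV([0,1]^d)` to `CH([0,1]^d)^*`. -/
def canonicalMap (d : ℕ) [NeZero d] : BV d →ₗ[ℝ] StrongDual ℝ (CH d) where
  toFun u := (NormedSpace.inclusionInDoubleDual ℝ (BV d) u).comp (chSubmodule d).subtypeL
  map_add' u w := by
    rw [map_add]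
    rfl
  map_smul' c u := by
    rw [map_smul]
    rfl

lemma canonicalMap_apply (u : BV d) (η : CH d) : canonicalMap d u η = η u := rfl

/-- The norm of `u` is a supremum over `div v` with `v` in the unit ball of `C([0,1]^d; ℝ^d)`, all
of which lie in the unit ball of `CH`. -/
lemma norm_canonicalMap (u : BV d) : ‖canonicalMap d u‖ = ‖u‖ := by
  refine le_antisymm (ContinuousLinearMap.opNorm_le_bound _ (norm_nonneg _) fun η => ?_) ?_
  · rw [canonicalMap_apply, mul_comm]
    exact η.toDual.le_opNorm u
  · refine ENNReal.toReal_le_of_le_ofReal (norm_nonneg _) (iSup₂_le fun v ⟨hv, hv1⟩ =>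
      ENNReal.ofReal_le_ofReal ?_)
    rw [← divPairing_restrictCube u hv]
    refine (le_abs_self _).trans (((canonicalMap d u).le_opNorm
      (divCH (restrictCube v hv.continuous))).trans (mul_le_of_le_one_right (norm_nonneg _) ?_))
    exact (norm_divCH_le _).trans ((ContinuousMap.norm_le _ zero_le_one).2 fun x => hv1 x)

/-- The canonical map as an isometric isomorphism. -/
def canonicalIso (d : ℕ) [NeZero d] : BV d ≃ₗᵢ[ℝ] StrongDual ℝ (CH d) :=
  LinearIsometryEquiv.ofSurjective ⟨canonicalMap d, norm_canonicalMap⟩ fun F => by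
    obtain ⟨u, hu⟩ := exists_BV_representing F
    exact ⟨u, ContinuousLinearMap.ext fun η => (hu η).symm⟩

end Duality

end BVDuality

end

/-- `BV([0,1]^d)` is isometrically the dual of `CH([0,1]^d)`, through `u ↦ (ω ↦ ω(u))`. The first
two clauses say that the objects are well defined: `Du` exists for every `u`, and `div` maps
`C([0,1]^d; ℝ^d)` into `BV([0,1]^d)^*`, with image `CH([0,1]^d)`. -/
theorem mainTheorem5 (d : ℕ) [NeZero d] :
    (∀ u : BVDuality.BV d, BVDuality.IsGradientMeasure u (BVDuality.gradientMeasure u)) ∧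
    (∀ v : C(BVDuality.cube d, EuclideanSpace ℝ (Fin d)),
      ∃ ω : BVDuality.CH d, ∀ u : BVDuality.BV d, ω u = BVDuality.divPairing v u) ∧
    CompleteSpace (BVDuality.BV d) ∧
    ∃ Υ : BVDuality.BV d ≃ₗᵢ[ℝ] StrongDual ℝ (BVDuality.CH d),
      ∀ (u : BVDuality.BV d) (ω : BVDuality.CH d), Υ u ω = ω u :=
  ⟨BVDuality.isGradientMeasure_gradientMeasure, fun v => ⟨BVDuality.divCH v, fun _ => rfl⟩,
    (BVDuality.canonicalIso d).toIsometryEquiv.completeSpace,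
    BVDuality.canonicalIso d, fun _ _ => rfl⟩
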